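/- \textbf{Setting.} Let $\pi$ and $q$ be probability measures on a measurable space $\mathbb X$ with $\pi\ll q$, let $\omega=d\pi/dq$ be (any measurable version of) the weight function, and assume $\omega>0$ $q$-almost surely. Let $f:\mathbb X\to\mathbb R$ be measurable and write $\pi(f)=\int f\,d\pi$. For $N\ge1$ let $\bar q=q^{\otimes N}$ and, for $\mathbf x=(x_1,\dots,x_N)\in\mathbb X^N$, let $$\hat Z(\mathbf x)=\frac1N\sum_{n=1}^N\omega(x_n),\qquad \hat F(\mathbf x)=\frac{\sum_{n=1}^N\omega(x_n)f(x_n)}{\sum_{n=1}^N\omega(x_n)} .$$ $\hat F(\mathbf x)$ with $\mathbf x\sim\bar q$ is the self-normalized importance sampling (IS) estimator. Draw independently $\mathbf x_0,\mathbf y_0\sim\bar q$, $u_0\sim\mathrm{Uniform}(0,1)$ and, for $t\ge1$, $\mathbf z_t\sim\bar q$, $u_t\sim\mathrm{Uniform}(0,1)$. Set $\mathbf x_1=\mathbf y_0$ if $u_0<\hat Z(\mathbf y_0)/\hat Z(\mathbf x_0)$, and $\mathbf x_1=\mathbf x_0$ otherwise. For $t\ge1$, set $\mathbf x_{t+1}=\mathbf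 z_t$ if $u_t<\hat Z(\mathbf z_t)/\hat Z(\mathbf x_t)$, and $\mathbf x_{t+1}=\mathbf x_t$ otherwise; set $\mathbf y_t=\mathbf z_t$ if $u_t<\hat Z(\mathbf z_t)/\hat Z(\mathbf y_{t-1})$, and $\mathbf y_t=\mathbf y_{t-1}$ otherwise. Let $\tau=\inf\{t\ge1:\mathbf x_t=\mathbf y_{t-1}\}$. The unbiased (UIS) estimator and its cost are $$\hat F_u=\hat F(\mathbf x_0)+\sum_{t=1}^{\tau-1}\{\hat F(\mathbf x_t)-\hat F(\mathbf y_{t-1})\},\qquad \mathcal C=2N+N(\tau-1).$$ \textbf{Proposition.} Suppose that there are $p\in(2,\infty)$ and $r\in(2,\infty]$ such that $q(\omega^p)<\infty$, $f\in L^r(q)$ (that is, $q(|f|^r)<\infty$ if $r<\infty$, and $f$ is $q$-essentially bounded if $r=\infty$), $q(f^2\omega^2)<\infty$, and $2p+4r+4<rp$ (read as $p>4$ if $r=\infty$). Then $\pi(|f|)<\infty$; for every $N\ge1$, $\tau<\infty$ almost surely and $\mathbb E[\mathcal C]$, $\mathbb E[(\hat F_u-\pi(f))^2]$ and $\mathbb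 E_{\mathbf x\sim\bar q}[(\hat F(\mathbf x)-\pi(f))^2]$ are finite; and both limits below exist in $\mathbb R$ and satisfy $$\lim_{N\to\infty}\mathbb E[\mathcal C]\cdot\mathbb E\big[(\hat F_u-\pi(f))^2\big]=2\lim_{N\to\infty}N\cdot\mathbb E_{\mathbf x\sim\bar q}\big[(\hat F(\mathbf x)-\pi(f))^2\big].$$ -/

import Mathlib

open MeasureTheory Filter Topology
open scoped ENNReal

noncomputable section

namespace UIS

variable {𝕏 : Type*}

/-- The average weight `Ẑ(x₁, …, x_N) = N⁻¹ ∑ₙ w(xₙ)`. -/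
def avgWeight (w : 𝕏 → ℝ) {N : ℕ} (x : Fin N → 𝕏) : ℝ :=
  (N : ℝ)⁻¹ * ∑ n, w (x n)

/-- The self-normalized importance sampling estimator
`F̂(x₁, …, x_N) = ∑ₙ w(xₙ) f(xₙ) / ∑ₙ w(xₙ)`. -/
def isEstimator (w f : 𝕏 → ℝ) {N : ℕ} (x : Fin N → 𝕏) : ℝ :=
  (∑ n, w (x n) * f (x n)) / ∑ n, w (x n)

open Classical in
/-- One accept/reject decision of particle independent Metropolis–Hastings from state `x`, with
proposal `z` and uniform variable `u`: move to `z` if `u < Ẑ(z) / Ẑ(x)`, otherwise stay at `x`. -/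
def pimhMove (w : 𝕏 → ℝ) {N : ℕ} (x z : Fin N → 𝕏) (u : unitInterval) : Fin N → 𝕏 :=
  if (u : ℝ) < avgWeight w z / avgWeight w x then z else x

/-- All the random inputs of the lagged coupled algorithm with `N` particles: the two initial
states `x₀`, `y₀`, the uniform variable used in the first step of the `x`-chain, and the sequence
of pairs (common proposal, common uniform variable) used in the successive coupled steps. -/
abbrev Noise (𝕏 : Type*) (N : ℕ) : Type _ :=
  (Fin N → 𝕏) × (Fin N → 𝕏) × unitInterval × (ℕ → (Fin N → 𝕏) × unitInterval)

/-- The law `q̄` of `N` independent draws from `q`. -/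
def qbar [MeasurableSpace 𝕏] (q : Measure 𝕏) [IsProbabilityMeasure q] (N : ℕ) :
    Measure (Fin N → 𝕏) :=
  Measure.pi fun _ => q

instance [MeasurableSpace 𝕏] (q : Measure 𝕏) [IsProbabilityMeasure q] (N : ℕ) :
    IsProbabilityMeasure (qbar q N) := by
  unfold qbar; infer_instance

/-- The joint law of the inputs: they are all independent, every state being drawn from `q̄`
and every uniform variable from the uniform law on the unit interval. -/
def noiseLaw [MeasurableSpace 𝕏] (q : Measure 𝕏) [IsProbabilityMeasure q] (N : ℕ) :
    Measure (Noise 𝕏 N) :=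
  (qbar q N).prod ((qbar q N).prod ((volume : Measure unitInterval).prod
    (Measure.infinitePi fun _ : ℕ => (qbar q N).prod (volume : Measure unitInterval))))

/-- The lagged coupled chains: `laggedPair w ζ t = (x_{t+1}, y_t)`. The first entry uses `y₀` as
the proposal for the move from `x₀` to `x₁`; each further pair is obtained from the previous one by
the common draws coupling (same proposal and same uniform variable for both chains). -/
def laggedPair (w : 𝕏 → ℝ) {N : ℕ} (ζ : Noise 𝕏 N) : ℕ → (Fin N → 𝕏) × (Fin N → 𝕏)
  | 0 => (pimhMove w ζ.1 ζ.2.1 ζ.2.2.1, ζ.2.1)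
  | t + 1 =>
      (pimhMove w (laggedPair w ζ t).1 (ζ.2.2.2 t).1 (ζ.2.2.2 t).2,
        pimhMove w (laggedPair w ζ t).2 (ζ.2.2.2 t).1 (ζ.2.2.2 t).2)

/-- The chain `(x_t)`. -/
def xChain (w : 𝕏 → ℝ) {N : ℕ} (ζ : Noise 𝕏 N) : ℕ → Fin N → 𝕏
  | 0 => ζ.1
  | t + 1 => (laggedPair w ζ t).1

/-- The chain `(y_t)`. -/
def yChain (w : 𝕏 → ℝ) {N : ℕ} (ζ : Noise 𝕏 N) (t : ℕ) : Fin N → 𝕏 :=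
  (laggedPair w ζ t).2

/-- The meeting time `τ = inf {t ≥ 1 : x_t = y_{t-1}}`, equal to `⊤` if the chains never meet
(written with `t = k + 1`). -/
def meetingTime (w : 𝕏 → ℝ) {N : ℕ} (ζ : Noise 𝕏 N) : ℕ∞ :=
  ⨅ (k : ℕ) (_ : xChain w ζ (k + 1) = yChain w ζ k), ((k + 1 : ℕ) : ℕ∞)

/-- The unbiased estimator `F̂ᵤ = F̂(x₀) + ∑_{t=1}^{τ-1} (F̂(x_t) - F̂(y_{t-1}))`
(written with `t = k + 1`; only meaningful where `τ < ∞`). -/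
def uisEstimator (w f : 𝕏 → ℝ) {N : ℕ} (ζ : Noise 𝕏 N) : ℝ :=
  isEstimator w f (xChain w ζ 0) +
    ∑ k ∈ Finset.range ((meetingTime w ζ).toNat - 1),
      (isEstimator w f (xChain w ζ (k + 1)) - isEstimator w f (yChain w ζ k))

/-- The cost `2N + N(τ - 1)` (only meaningful where `τ < ∞`). -/
def uisCost (w : 𝕏 → ℝ) {N : ℕ} (ζ : Noise 𝕏 N) : ℝ :=
  2 * N + N * (((meetingTime w ζ).toNat : ℝ) - 1)

end UIS

end

/-! Write c = π(f), and let K be the number of proposals that the x-chain rejects before its first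
acceptance. Until then x stays at x₀, while y starts at the first rejected proposal and moves only
among rejected proposals, all of smaller average weight than x₀. A lighter state accepts whatever a
heavier one accepts, so the first proposal accepted by x is also taken by y. Hence almost surely τ =
K + 1, the cost is N(2 + K), and the correction F̂ᵤ - F̂(x₀) is a sum of K differences F̂(x₀) -
F̂(y_k) (`Regular.meetingTime_eq`, `Regular.uisEstimator_eq`).

Three limits then suffice: E[K] → 0, N·E[correction²] → 0, and N·E[(F̂ - c)²] → σ² = q(w²(f - c)²).
Young's inequality disposes of the cross term, F̂ᵤ has the same limit σ², and the product (2 +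
E[K])·N·E[(F̂ᵤ - c)²] tends to 2σ².

Given x₀, K is geometric with success probability at least c₀ / max(1, Ẑ(x₀)), where c₀ = q(min(1,
w)) does not depend on N. A proposal z is rejected with probability at most D(x₀) + D(z), where D =
min(1, 4|Ẑ - 1|) vanishes in mean. `lintegral_rejections_le` combines the two. The powers of max(1,
Ẑ(x₀)) that it produces are harmless: against the error at an independent proposal, the cube is
controlled by the fourth moment of w; against the error at x₀ itself, the identity Ẑ·(F̂ - c) =
average of w(f - c) absorbs the square.

It remains that N·average² integrates to o(1) against D, which is a uniform integrability statement
(`tendsto_integral_avgWeight_sq_mul`), and that the event Ẑ < 1/2, where the average no longer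
controls F̂ - c, is exponentially unlikely (`tendsto_integral_sum_sq_mul_lowWeight`). The moment
conditions enter through w ∈ L⁴(q), f ∈ L²(q) and wf ∈ L²(q). -/

namespace UIS

open ProbabilityTheory

/-! ### Second and fourth moments of independent sums. -/

section Moments

variable {Ω : Type*} [MeasurableSpace Ω] {μ : Measure Ω} [IsProbabilityMeasure μ]

lemma integrable_pow_of_memLp {X : Ω → ℝ} {n k : ℕ} (hX : MemLp X n μ) (hk : k ≤ n) :
    Integrable (fun ω => X ω ^ k) μ := by
  have h := (hX.mono_exponent (p := (k : ℝ≥0∞)) (by exact_mod_cast hk)).integrable_norm_pow'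
  refine h.mono' (hX.1.pow k) (ae_of_all _ fun ω => ?_)
  simp

omit [IsProbabilityMeasure μ] in
lemma memLp_four_of_integrable {X : Ω → ℝ} (hX : AEStronglyMeasurable X μ)
    (h : Integrable (fun ω => X ω ^ 4) μ) : MemLp X 4 μ := by
  rw [← integrable_norm_rpow_iff hX (by norm_num) (by norm_num)]
  refine h.congr (ae_of_all _ fun ω => ?_)
  have : (4 : ℝ≥0∞).toReal = ((4 : ℕ) : ℝ) := by simp
  simp only [this, Real.rpow_natCast, Real.norm_eq_abs]
  rw [Even.pow_abs (by decide)]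

/-- The fourth moment of a sum of independent centred variables. -/
lemma integral_sum_pow_four_le {ι : Type*} {X : ι → Ω → ℝ} (hind : iIndepFun X μ)
    (hm : ∀ i, Measurable (X i)) (h4 : ∀ i, MemLp (X i) 4 μ) (h0 : ∀ i, ∫ ω, X i ω ∂μ = 0)
    {a b : ℝ} (ha : ∀ i, ∫ ω, X i ω ^ 2 ∂μ = a) (hb : ∀ i, ∫ ω, X i ω ^ 4 ∂μ = b)
    (s : Finset ι) :
    ∫ ω, (∑ i ∈ s, X i) ω ∂μ = 0 ∧ ∫ ω, (∑ i ∈ s, X i) ω ^ 2 ∂μ = s.card * a ∧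
      ∫ ω, (∑ i ∈ s, X i) ω ^ 4 ∂μ ≤ 3 * (s.card : ℝ) ^ 2 * b := by
  classical
  induction s using Finset.induction_on with
  | empty => simp
  | insert i s his ih =>
    obtain ⟨ih1, ih2, ih4⟩ := ih
    set S : Ω → ℝ := ∑ j ∈ s, X j with hS
    have hSm : Measurable S := by
      simpa only [hS, Finset.sum_fn] using Finset.measurable_sum s fun j _ => hm j
    have hS4 : MemLp S ((4 : ℕ) : ℝ≥0∞) μ := by
      simpa using memLp_finsetSum' s fun j _ => h4 j
    have hX4 : MemLp (X i) ((4 : ℕ) : ℝ≥0∞) μ := by simpa using h4 i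
    have hI : IndepFun S (X i) μ := hind.indepFun_finsetSum_of_notMem hm his
    have iS : ∀ k ≤ 4, Integrable (fun ω => S ω ^ k) μ := fun k hk => integrable_pow_of_memLp hS4 hk
    have iX : ∀ k ≤ 4, Integrable (fun ω => X i ω ^ k) μ := fun k hk =>
      integrable_pow_of_memLp hX4 hk
    have hIp : ∀ k l : ℕ, IndepFun (fun ω => S ω ^ k) (fun ω => X i ω ^ l) μ := fun k l =>
      hI.comp (φ := fun t => t ^ k) (ψ := fun t => t ^ l) (measurable_id.pow_const k)
        (measurable_id.pow_const l)
    have iP : ∀ k ≤ 4, ∀ l ≤ 4, Integrable (fun ω => S ω ^ k * X i ω ^ l) μ := fun k hk l hl =>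
      (hIp k l).integrable_mul (iS k hk) (iX l hl)
    have eP : ∀ k l : ℕ, ∫ ω, S ω ^ k * X i ω ^ l ∂μ
        = (∫ ω, S ω ^ k ∂μ) * ∫ ω, X i ω ^ l ∂μ := fun k l =>
      (hIp k l).integral_mul_eq_mul_integral (hSm.pow_const k).aestronglyMeasurable
        ((hm i).pow_const l).aestronglyMeasurable
    have iS1 : Integrable S μ := by simpa using iS 1 (by norm_num)
    have iX1 : Integrable (X i) μ := by simpa using iX 1 (by norm_num)
    have e11 := eP 1 1
    have e31 := eP 3 1
    have e22 := eP 2 2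
    have e13 := eP 1 3
    simp only [pow_one] at e11 e31 e13
    have i11 := iP 1 (by norm_num) 1 (by norm_num)
    have i31 := iP 3 (by norm_num) 1 (by norm_num)
    have i22 := iP 2 (by norm_num) 2 (by norm_num)
    have i13 := iP 1 (by norm_num) 3 (by norm_num)
    simp only [pow_one] at i11 i31 i13
    rw [Finset.sum_insert his, Finset.card_insert_of_notMem his]
    simp only [Pi.add_apply]
    rw [← hS]
    -- The variance of X² is nonnegative. The induction closes because b + 6na² + 3n²b ≤ 3(n + 1)²b.
    have hab : a ^ 2 ≤ b := by
      have hv := variance_nonneg (fun ω => X i ω ^ 2) μ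
      have hmem : MemLp (fun ω => X i ω ^ 2) 2 μ := by
        rw [memLp_two_iff_integrable_sq (by fun_prop)]
        refine (iX 4 le_rfl).congr (ae_of_all _ fun ω => by ring)
      rw [variance_eq_sub hmem] at hv
      have : ∫ ω, ((fun ω => X i ω ^ 2) ^ 2) ω ∂μ = b := by
        rw [← hb i]; exact integral_congr_ae (ae_of_all _ fun ω => by simp; ring)
      rw [this, ha i] at hv
      linarith
    have hb0 : 0 ≤ b := (sq_nonneg a).trans hab
    refine ⟨?_, ?_, ?_⟩
    · rw [integral_add iX1 iS1, h0, ih1, add_zero]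
    · have : ∀ ω, (X i ω + S ω) ^ 2 = X i ω ^ 2 + 2 * (S ω * X i ω) + S ω ^ 2 := fun ω => by ring
      simp_rw [this]
      have j1 : Integrable (fun ω => X i ω ^ 2 + 2 * (S ω * X i ω)) μ :=
        (iX 2 (by norm_num)).add (i11.const_mul 2)
      rw [integral_add j1 (iS 2 (by norm_num)),
        integral_add (iX 2 (by norm_num)) (i11.const_mul 2), integral_const_mul, e11, h0, ha, ih2]
      push_cast; ring
    · have : ∀ ω, (X i ω + S ω) ^ 4 = X i ω ^ 4 + 4 * (S ω * X i ω ^ 3)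
          + 6 * (S ω ^ 2 * X i ω ^ 2) + 4 * (S ω ^ 3 * X i ω) + S ω ^ 4 := fun ω => by ring
      simp_rw [this]
      have j4 := iX 4 le_rfl
      have j1 : Integrable (fun ω => X i ω ^ 4 + 4 * (S ω * X i ω ^ 3)) μ :=
        j4.add (i13.const_mul 4)
      have j2 : Integrable (fun ω => X i ω ^ 4 + 4 * (S ω * X i ω ^ 3)
          + 6 * (S ω ^ 2 * X i ω ^ 2)) μ := j1.add (i22.const_mul 6)
      have j3 : Integrable (fun ω => X i ω ^ 4 + 4 * (S ω * X i ω ^ 3)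
          + 6 * (S ω ^ 2 * X i ω ^ 2) + 4 * (S ω ^ 3 * X i ω)) μ := j2.add (i31.const_mul 4)
      rw [integral_add j3 (iS 4 le_rfl), integral_add j2 (i31.const_mul 4),
        integral_add j1 (i22.const_mul 6), integral_add j4 (i13.const_mul 4)]
      simp only [integral_const_mul, e13, e22, e31, h0, hb, ha, ih1, ih2]
      push_cast
      nlinarith [mul_le_mul_of_nonneg_left hab (Nat.cast_nonneg (α := ℝ) s.card)]

end Moments

/-! ### Moments and uniform integrability of averages under q̄. -/

section Average

variable {𝕏 : Type*} [MeasurableSpace 𝕏] {q : Measure 𝕏} [IsProbabilityMeasure q]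

lemma measurePreserving_coord (N : ℕ) (i : Fin N) :
    MeasurePreserving (fun x : Fin N → 𝕏 => x i) (qbar q N) q :=
  measurePreserving_eval (fun _ : Fin N => q) i

lemma ae_qbar_forall {P : 𝕏 → Prop} (h : ∀ᵐ x ∂q, P x) (N : ℕ) :
    ∀ᵐ x ∂(qbar q N), ∀ i, P (x i) :=
  ae_all_iff.2 fun i => (measurePreserving_coord N i).quasiMeasurePreserving.ae h

@[fun_prop]
lemma measurable_avgWeight {h : 𝕏 → ℝ} (hh : Measurable h) {N : ℕ} :
    Measurable (fun x : Fin N → 𝕏 => avgWeight h x) := by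
  unfold avgWeight; fun_prop

@[fun_prop]
lemma measurable_isEstimator {w f : 𝕏 → ℝ} (hw : Measurable w) (hf : Measurable f) {N : ℕ} :
    Measurable (fun x : Fin N → 𝕏 => isEstimator w f x) := by
  unfold isEstimator; fun_prop

lemma memLp_avgWeight {h : 𝕏 → ℝ} {p : ℝ≥0∞} (hh : MemLp h p q) (N : ℕ) :
    MemLp (fun x : Fin N → 𝕏 => avgWeight h x) p (qbar q N) := by
  unfold avgWeight
  exact (memLp_finsetSum _ fun i _ =>
    hh.comp_measurePreserving (measurePreserving_coord N i)).const_mul _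

lemma integral_avgWeight_sq {h : 𝕏 → ℝ} (hh : MemLp h 2 q) (h0 : ∫ x, h x ∂q = 0) (N : ℕ) :
    ∫ x, avgWeight h x ^ 2 ∂(qbar q N) = (N : ℝ)⁻¹ * ∫ x, h x ^ 2 ∂q := by
  have hv := variance_sum_pi (ι := Fin N) (μ := fun _ => q) (X := fun _ => h) (fun _ => hh)
  have hS : MemLp (∑ i : Fin N, fun x : Fin N → 𝕏 => h (x i)) 2 (qbar q N) :=
    memLp_finsetSum' _ fun i _ => hh.comp_measurePreserving (measurePreserving_coord N i)
  have hS0 : ∫ x, (∑ i : Fin N, fun x : Fin N → 𝕏 => h (x i)) x ∂(qbar q N) = 0 := by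
    simp only [Finset.sum_apply]
    have hi : ∀ i : Fin N, Integrable (fun x : Fin N → 𝕏 => h (x i)) (qbar q N) := fun i =>
      (hh.comp_measurePreserving (measurePreserving_coord N i)).integrable one_le_two
    rw [integral_finsetSum _ fun i _ => hi i]
    refine Finset.sum_eq_zero fun i _ => ?_
    unfold qbar
    rw [integral_comp_eval (μ := fun _ : Fin N => q) hh.1, h0]
  change Var[_; qbar q N] = _ at hv
  rw [variance_eq_integral hS.aemeasurable, hS0,
    variance_eq_integral hh.aemeasurable, h0] at hv
  simp only [Finset.sum_apply, sub_zero, Finset.sum_const, Finset.card_univ,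
    Fintype.card_fin, nsmul_eq_mul] at hv
  simp_rw [avgWeight, mul_pow]
  rw [integral_const_mul, hv]
  rcases eq_or_ne (N : ℝ) 0 with hN | hN
  · simp [hN]
  · field_simp

lemma integral_avgWeight_pow_four_le {h : 𝕏 → ℝ} (hm : Measurable h) (hh : MemLp h 4 q)
    (h0 : ∫ x, h x ∂q = 0) (N : ℕ) :
    (N : ℝ) ^ 2 * ∫ x, avgWeight h x ^ 4 ∂(qbar q N) ≤ 3 * ∫ x, h x ^ 4 ∂q := by
  have hind : iIndepFun (fun (i : Fin N) (x : Fin N → 𝕏) => h (x i)) (qbar q N) :=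
    iIndepFun_pi (fun _ => hm.aemeasurable)
  have key := (integral_sum_pow_four_le hind (fun i => by fun_prop)
    (fun i => hh.comp_measurePreserving (measurePreserving_coord N i))
    (fun i => by unfold qbar; rw [integral_comp_eval (μ := fun _ : Fin N => q) hh.1, h0])
    (a := ∫ x, h x ^ 2 ∂q) (b := ∫ x, h x ^ 4 ∂q)
    (fun i => integral_comp_eval (μ := fun _ : Fin N => q) (f := fun x => h x ^ 2)
      (hm.pow_const 2).aestronglyMeasurable)
    (fun i => integral_comp_eval (μ := fun _ : Fin N => q) (f := fun x => h x ^ 4)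
      (hm.pow_const 4).aestronglyMeasurable) Finset.univ).2.2
  simp only [Finset.sum_apply, Finset.card_univ, Fintype.card_fin] at key
  simp_rw [avgWeight, mul_pow]
  rw [integral_const_mul]
  have hb : 0 ≤ ∫ x, h x ^ 4 ∂q := integral_nonneg fun x => by positivity
  rcases eq_or_ne (N : ℝ) 0 with hN | hN
  · simp only [hN]; norm_num; positivity
  · calc _ ≤ (N : ℝ) ^ 2 * ((N : ℝ)⁻¹ ^ 4 * (3 * (N : ℝ) ^ 2 * ∫ x, h x ^ 4 ∂q)) := by gcongr
      _ = _ := by field_simp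

/-- Squared centred averages, rescaled by the sample size, are uniformly integrable: they
integrate to a vanishing quantity against bounded functions that vanish in mean. -/
lemma tendsto_integral_avgWeight_sq_mul {h : 𝕏 → ℝ} (hh : MemLp h 2 q)
    (h0 : ∫ x, h x ∂q = 0) {φ : (N : ℕ) → (Fin N → 𝕏) → ℝ} (hφm : ∀ N, Measurable (φ N))
    (hφ0 : ∀ N x, 0 ≤ φ N x) (hφ1 : ∀ N x, φ N x ≤ 1)
    (hφ : Tendsto (fun N => ∫ x, φ N x ∂(qbar q N)) atTop (𝓝 0)) :
    Tendsto (fun N : ℕ => N * ∫ x, avgWeight h x ^ 2 * φ N x ∂(qbar q N)) atTop (𝓝 0) := by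
  have hpos : ∀ N : ℕ, 0 ≤ (N : ℝ) * ∫ x, avgWeight h x ^ 2 * φ N x ∂(qbar q N) := fun N =>
    mul_nonneg N.cast_nonneg (integral_nonneg fun x => mul_nonneg (sq_nonneg _) (hφ0 N x))
  have hφi : ∀ N, Integrable (φ N) (qbar q N) := fun N =>
    Integrable.of_bound (hφm N).aestronglyMeasurable 1 (ae_of_all _ fun x => by
      rw [Real.norm_eq_abs, abs_of_nonneg (hφ0 N x)]; exact hφ1 N x)
  rw [Metric.tendsto_atTop]
  intro ε hε
  -- Split h into a centred simple part h₁, whose average has a fourth moment of order N⁻², and a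
  -- centred remainder h₂ that is small in L². This works without a moment of h above the second.
  obtain ⟨g, hg, -⟩ := hh.exists_simpleFunc_eLpNorm_sub_lt (by norm_num)
    (ε := ENNReal.ofReal (Real.sqrt (ε / 8))) (by
      simp only [ne_eq, ENNReal.ofReal_eq_zero, not_le]; positivity)
  set m : ℝ := ∫ x, g x ∂q
  set h₁ : 𝕏 → ℝ := fun x => g x - m
  set h₂ : 𝕏 → ℝ := fun x => h x - h₁ x
  have hgL : ∀ p : ℝ≥0∞, MemLp g p q := fun p => g.memLp_of_isFiniteMeasure p q
  have h1L : ∀ p : ℝ≥0∞, MemLp h₁ p q := fun p => (hgL p).sub (memLp_const m)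
  have h1m : Measurable h₁ := g.measurable.sub_const m
  have h10 : ∫ x, h₁ x ∂q = 0 := by
    simp only [h₁]
    rw [integral_sub ((hgL 1).integrable le_rfl) (integrable_const _)]
    simp [m]
  have h2L : MemLp h₂ 2 q := hh.sub (h1L 2)
  have h20 : ∫ x, h₂ x ∂q = 0 := by
    simp only [h₂]
    rw [integral_sub (hh.integrable one_le_two) ((h1L 1).integrable le_rfl), h10, h0, sub_zero]
  have hdL : MemLp (fun x => h x - g x) 2 q := hh.sub (hgL 2)
  have hd : ∫ x, (h x - g x) ^ 2 ∂q ≤ ε / 8 := by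
    have e1 := hdL.eLpNorm_eq_integral_rpow_norm (by norm_num) (by norm_num)
    change eLpNorm (fun x => h x - g x) 2 q < _ at hg
    rw [e1, ENNReal.ofReal_lt_ofReal_iff (by positivity)] at hg
    have e2 : ∫ x, ‖h x - g x‖ ^ (2 : ℝ≥0∞).toReal ∂q = ∫ x, (h x - g x) ^ 2 ∂q :=
      integral_congr_ae (ae_of_all _ fun x => by simp)
    rw [e2] at hg
    have e3 : (2 : ℝ≥0∞).toReal⁻¹ = 1 / 2 := by norm_num
    rw [e3, ← Real.sqrt_eq_rpow] at hg
    exact (Real.sqrt_lt_sqrt_iff (integral_nonneg fun x => sq_nonneg _)).1 hg |>.le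
  -- Since h is centred, h₂ is h - g minus its mean -m, and centring can only lower the second
  -- moment.
  have h2sq : ∫ x, h₂ x ^ 2 ∂q ≤ ε / 8 := by
    refine le_trans ?_ hd
    have hmean : ∫ x, (h x - g x) ∂q = -m := by
      rw [integral_sub (hh.integrable one_le_two) ((hgL 1).integrable le_rfl), h0, zero_sub]
    have : ∀ x, h₂ x ^ 2 = (h x - g x) ^ 2 + (2 * m * (h x - g x) + m ^ 2) := fun x => by
      simp only [h₂, h₁]; ring
    simp_rw [this]
    have j1 : Integrable (fun x => 2 * m * (h x - g x) + m ^ 2) q :=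
      ((hdL.integrable one_le_two).const_mul _).add (integrable_const _)
    rw [integral_add hdL.integrable_sq j1,
      integral_add ((hdL.integrable one_le_two).const_mul _) (integrable_const _),
      integral_const_mul, hmean]
    simp
    nlinarith [sq_nonneg m]
  set b : ℝ := ∫ x, h₁ x ^ 4 ∂q
  have hb : 0 ≤ b := integral_nonneg fun x => by positivity
  -- Weight for Young's inequality: small enough that the fourth-moment term 2η·3b costs at most
  -- ε/4, while the factor 1/(2η) on the mean of φ is compensated by taking N large. The `+ 1`
  -- covers b = 0.
  set η : ℝ := ε / (8 * (3 * b + 1))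
  have hη : 0 < η := by positivity
  have hηb : η * (3 * b) ≤ ε / 8 := by
    simp only [η]
    rw [div_mul_eq_mul_div, div_le_div_iff₀ (by positivity) (by norm_num)]
    nlinarith
  obtain ⟨N₀, hN₀⟩ := (Metric.tendsto_atTop.1 hφ) (ε * η / 4) (by positivity)
  refine ⟨N₀, fun N hN => ?_⟩
  have hφN := hN₀ N hN
  rw [Real.dist_eq, sub_zero, abs_of_nonneg (integral_nonneg (hφ0 N))] at hφN
  rw [Real.dist_eq, sub_zero, abs_of_nonneg (hpos N)]
  have havg : ∀ x : Fin N → 𝕏, avgWeight h x = avgWeight h₁ x + avgWeight h₂ x := fun x => by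
    simp only [avgWeight, h₂, ← mul_add, ← Finset.sum_add_distrib]
    simp
  -- Young's inequality on the h₁ part, with φ² ≤ φ, and φ ≤ 1 on the h₂ part. The three terms
  -- integrate to at most ε/4, ε/8 and ε/4.
  have hpt : ∀ x : Fin N → 𝕏, N * (avgWeight h x ^ 2 * φ N x) ≤
      2 * η * ((N : ℝ) ^ 2 * avgWeight h₁ x ^ 4) + (1 / (2 * η)) * φ N x
        + 2 * (N * avgWeight h₂ x ^ 2) := by
    intro x
    rw [havg]
    set A := avgWeight h₁ x
    set B := avgWeight h₂ x
    have p0 := hφ0 N x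
    have p1 := hφ1 N x
    have s1 : (A + B) ^ 2 ≤ 2 * A ^ 2 + 2 * B ^ 2 := by nlinarith [sq_nonneg (A - B)]
    have hN0 : (0 : ℝ) ≤ N := N.cast_nonneg
    have s2 : N * ((A + B) ^ 2 * φ N x) ≤ N * ((2 * A ^ 2 + 2 * B ^ 2) * φ N x) := by gcongr
    have s3 : (N : ℝ) * B ^ 2 * φ N x ≤ N * B ^ 2 * 1 := by gcongr
    have s4 : 2 * (N * A ^ 2) * φ N x ≤ 2 * η * ((N : ℝ) ^ 2 * A ^ 4) + 1 / (2 * η) * φ N x := by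
      have t1 : 2 * (N * A ^ 2) * φ N x ≤
          2 * η * (N * A ^ 2) ^ 2 + 1 / (2 * η) * φ N x ^ 2 := by
        have := sq_nonneg (2 * η * (N * A ^ 2) - φ N x)
        have e : 2 * η * (N * A ^ 2) ^ 2 + 1 / (2 * η) * φ N x ^ 2 - 2 * (N * A ^ 2) * φ N x
          = (2 * η * (N * A ^ 2) - φ N x) ^ 2 / (2 * η) := by field_simp; ring
        have : 0 ≤ (2 * η * (N * A ^ 2) - φ N x) ^ 2 / (2 * η) := by positivity
        linarith
      have t2 : 1 / (2 * η) * φ N x ^ 2 ≤ 1 / (2 * η) * φ N x := by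
        gcongr; nlinarith
      nlinarith
    nlinarith
  have i1 : Integrable (fun x : Fin N → 𝕏 => avgWeight h₁ x ^ 4) (qbar q N) :=
    integrable_pow_of_memLp (n := 4) (memLp_avgWeight (h1L _) N) le_rfl
  have i2 : Integrable (fun x : Fin N → 𝕏 => avgWeight h₂ x ^ 2) (qbar q N) :=
    (memLp_avgWeight h2L N).integrable_sq
  have i3 : Integrable (fun x : Fin N → 𝕏 => N * (avgWeight h x ^ 2 * φ N x)) (qbar q N) := by
    refine Integrable.const_mul ?_ _
    have i0 := (memLp_avgWeight hh N).integrable_sq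
    refine i0.mono' (i0.1.mul (hφm N).aestronglyMeasurable) (ae_of_all _ fun x => ?_)
    rw [Real.norm_eq_abs, abs_of_nonneg (mul_nonneg (sq_nonneg _) (hφ0 N x))]
    exact mul_le_of_le_one_right (sq_nonneg _) (hφ1 N x)
  have i4 := (i1.const_mul ((N : ℝ) ^ 2)).const_mul (2 * η)
  have i5 := (hφi N).const_mul (1 / (2 * η))
  have i6 := (i2.const_mul (N : ℝ)).const_mul 2
  have hle := integral_mono i3 ((i4.add i5).add i6) hpt
  rw [integral_add' (i4.add i5) i6, integral_add' i4 i5, integral_const_mul, integral_const_mul,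
    integral_const_mul, integral_const_mul, integral_const_mul, integral_const_mul,
    integral_avgWeight_sq h2L h20] at hle
  have f1 : 2 * η * ((N : ℝ) ^ 2 * ∫ x, avgWeight h₁ x ^ 4 ∂(qbar q N)) ≤ ε / 4 := by
    have := mul_le_mul_of_nonneg_left (integral_avgWeight_pow_four_le h1m (h1L 4) h10 N)
      (by positivity : 0 ≤ 2 * η)
    linarith
  have f2 : 1 / (2 * η) * ∫ x, φ N x ∂(qbar q N) ≤ ε / 8 := by
    calc _ ≤ 1 / (2 * η) * (ε * η / 4) := by gcongr
      _ = ε / 8 := by field_simp; norm_num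
  have f3 : 2 * ((N : ℝ) * ((N : ℝ)⁻¹ * ∫ x, h₂ x ^ 2 ∂q)) ≤ ε / 4 := by
    have h2n : 0 ≤ ∫ x, h₂ x ^ 2 ∂q := integral_nonneg fun x => sq_nonneg _
    rw [← mul_assoc (N : ℝ)]
    have : (N : ℝ) * (N : ℝ)⁻¹ ≤ 1 := mul_inv_le_one
    nlinarith
  linarith

end Average

/-! ### First success in an i.i.d. sequence. -/

section Geometric

/-- The index of the first term of the sequence `ω` that lies in `A` (`0` if there is none). -/
noncomputable def firstHit {P : Type*} (A : Set P) (ω : ℕ → P) : ℕ := sInf {n | ω n ∈ A}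

/-- Compare (n + 1)^k with the rising factorial k!·C(n + k, k), whose geometric series sums exactly
to k!·α^{-(k+1)}. -/
lemma tsum_pow_mul_geometric_le {α β : ℝ≥0∞} (hαβ : α + β = 1) (hα : α ≠ 0) (k : ℕ) :
    α * ∑' n : ℕ, ((n : ℝ≥0∞) + 1) ^ k * β ^ n ≤ k.factorial * α⁻¹ ^ k := by
  have hβ1 : β ≤ 1 := hαβ ▸ le_add_self
  have hα1 : α ≤ 1 := hαβ ▸ le_self_add
  lift α to NNReal using (hα1.trans_lt ENNReal.one_lt_top).ne
  lift β to NNReal using (hβ1.trans_lt ENNReal.one_lt_top).ne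
  have hab : (α : ℝ) + β = 1 := by exact_mod_cast hαβ
  have ha : 0 < (α : ℝ) := by
    have : α ≠ 0 := by simpa using hα
    exact_mod_cast pos_iff_ne_zero.2 this
  have hb : ‖(β : ℝ)‖ < 1 := by
    rw [Real.norm_of_nonneg β.coe_nonneg]; linarith
  have hle : ∀ n : ℕ, ((n : ℝ≥0∞) + 1) ^ k * (β : ℝ≥0∞) ^ n ≤
      k.factorial * ENNReal.ofReal (((n + k).choose k : ℝ) * (β : ℝ) ^ n) := by
    intro n
    have h1 : (n + 1) ^ k ≤ k.factorial * (n + k).choose k := by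
      have := Nat.pow_succ_le_ascFactorial (n + 1) k
      rwa [Nat.ascFactorial_eq_factorial_mul_choose] at this
    have h2 : ((n : ℝ≥0∞) + 1) ^ k ≤ k.factorial * (n + k).choose k := by exact_mod_cast h1
    rw [ENNReal.ofReal_mul (by positivity), ENNReal.ofReal_natCast, ENNReal.ofReal_pow β.coe_nonneg,
      ENNReal.ofReal_coe_nnreal, ← mul_assoc]
    gcongr
  have hs := hasSum_choose_mul_geometric_of_norm_lt_one k hb
  calc (α : ℝ≥0∞) * ∑' n : ℕ, ((n : ℝ≥0∞) + 1) ^ k * (β : ℝ≥0∞) ^ n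
      ≤ α * ∑' n : ℕ, k.factorial * ENNReal.ofReal (((n + k).choose k : ℝ) * (β : ℝ) ^ n) := by
        exact mul_le_mul_right (ENNReal.tsum_le_tsum hle) _
    _ = k.factorial * (α * ENNReal.ofReal (1 / (1 - (β : ℝ)) ^ (k + 1))) := by
        rw [ENNReal.tsum_mul_left, ← ENNReal.ofReal_tsum_of_nonneg (fun n => by positivity)
          hs.summable, hs.tsum_eq]
        ring
    _ = k.factorial * (α : ℝ≥0∞)⁻¹ ^ k := by
        rw [show 1 - (β : ℝ) = α by linarith, one_div, ENNReal.ofReal_inv_of_pos (by positivity),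
          ENNReal.ofReal_pow α.coe_nonneg, ENNReal.ofReal_coe_nnreal, pow_succ', ENNReal.mul_inv
          (Or.inl hα) (Or.inl ENNReal.coe_ne_top), ← mul_assoc (α : ℝ≥0∞),
          ENNReal.mul_inv_cancel hα ENNReal.coe_ne_top, one_mul, ENNReal.inv_pow]

variable {P : Type*} [MeasurableSpace P]

lemma measurable_firstHit {A : Set P} (hA : MeasurableSet A) : Measurable (firstHit A) := by
  refine measurable_to_countable' fun m => ?_
  have hE : ∀ n, MeasurableSet {ω : ℕ → P | ω n ∈ A} := fun n => measurable_pi_apply n hA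
  -- The second set accounts for the default value 0 of `sInf ∅` when there is no success.
  have : firstHit A ⁻¹' {m} = ({ω : ℕ → P | ω m ∈ A} ∩ ⋂ i ∈ Set.Iio m, {ω | ω i ∈ A}ᶜ) ∪
      ({_ω | m = 0} ∩ ⋂ i, {ω | ω i ∈ A}ᶜ) := by
    ext ω
    simp only [Set.mem_preimage, Set.mem_singleton_iff, Set.mem_union, Set.mem_inter_iff,
      Set.mem_ofPred_eq, Set.mem_iInter, Set.mem_compl_iff, Set.mem_Iio, firstHit]
    constructor
    · rintro rfl
      rcases Set.eq_empty_or_nonempty {n | ω n ∈ A} with he | hne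
      · right
        refine ⟨by simp [he], fun i hi => ?_⟩
        have : i ∈ {n | ω n ∈ A} := hi
        rw [he] at this; exact this
      · exact Or.inl ⟨Nat.sInf_mem hne, fun i hi => Nat.notMem_of_lt_sInf hi⟩
    · rintro (⟨h1, h2⟩ | ⟨rfl, h2⟩)
      · refine le_antisymm (Nat.sInf_le h1) (not_lt.1 fun hlt => ?_)
        exact h2 _ hlt (Nat.sInf_mem (s := {n | ω n ∈ A}) ⟨m, h1⟩)
      · have : {n | ω n ∈ A} = ∅ := Set.eq_empty_of_forall_notMem fun i hi => h2 i hi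
        simp [this]
  rw [this]
  refine ((hE m).inter (MeasurableSet.biInter (Set.to_countable _) fun i _ => (hE i).compl)).union
    ((MeasurableSet.const _).inter (MeasurableSet.iInter fun i => (hE i).compl))

variable {ν : Measure P} [IsProbabilityMeasure ν]

lemma lintegral_prod_range_infinitePi {φ : ℕ → P → ℝ≥0∞} (hφ : ∀ i, Measurable (φ i)) (n : ℕ) :
    ∫⁻ ω, ∏ i ∈ Finset.range n, φ i (ω i) ∂(Measure.infinitePi fun _ : ℕ => ν)
      = ∏ i ∈ Finset.range n, ∫⁻ p, φ i p ∂ν := by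
  rw [lintegral_prod_eq_prod_lintegral_of_indepFun (Finset.range n)
    (fun i (ω : ℕ → P) => φ i (ω i)) (iIndepFun_infinitePi fun i => hφ i)
    (fun i => (hφ i).comp (measurable_pi_apply i))]
  refine Finset.prod_congr rfl fun i _ => ?_
  exact (measurePreserving_eval_infinitePi (fun _ : ℕ => ν) i).lintegral_comp (hφ i)

lemma ae_exists_mem_infinitePi {A : Set P} (hA : MeasurableSet A) (h : ν A ≠ 0) :
    ∀ᵐ ω ∂(Measure.infinitePi fun _ : ℕ => ν), ∃ n, ω n ∈ A := by
  have hβ : ν Aᶜ < 1 := by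
    rw [prob_compl_eq_one_sub hA]
    exact ENNReal.sub_lt_self ENNReal.one_ne_top one_ne_zero h
  have hle : ∀ n : ℕ, (Measure.infinitePi fun _ : ℕ => ν) {ω | ¬ ∃ n, ω n ∈ A} ≤ ν Aᶜ ^ n := by
    intro n
    calc _ ≤ (Measure.infinitePi fun _ : ℕ => ν) ((Finset.range n : Set ℕ).pi fun _ => Aᶜ) :=
          by
          refine measure_mono fun ω hω => ?_
          have hω' : ¬ ∃ n, ω n ∈ A := hω
          exact fun i _ hi => hω' ⟨i, hi⟩
      _ = _ := by
          rw [Measure.infinitePi_pi _ fun _ _ => hA.compl]; simp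
  exact le_antisymm (ge_of_tendsto' (ENNReal.tendsto_pow_atTop_nhds_zero_of_lt_one hβ) hle)
    zero_le

/-- A moment bound for the number of failures before the first success. -/
lemma lintegral_firstHit_le {A : Set P} (hA : MeasurableSet A) (h : ν A ≠ 0) {g : P → ℝ≥0∞}
    (hg : Measurable g) (j : ℕ) :
    ∫⁻ ω, (firstHit A ω : ℝ≥0∞) ^ j * ∑ s ∈ Finset.range (firstHit A ω), g (ω s)
        ∂(Measure.infinitePi fun _ : ℕ => ν)
      ≤ (j + 1).factorial * (∫⁻ p in Aᶜ, g p ∂ν) * (ν A)⁻¹ ^ (j + 1) := by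
  set μ := Measure.infinitePi fun _ : ℕ => ν
  set γ := ∫⁻ p in Aᶜ, g p ∂ν
  -- The product of these factors over i ≤ m is g(ω_s) times the indicator that the first success
  -- occurs at m, for s < m. It has one factor per coordinate, so independence evaluates its
  -- integral.
  let φ : ℕ → ℕ → ℕ → P → ℝ≥0∞ := fun m s i p =>
    if i = m then A.indicator 1 p else if i = s then Aᶜ.indicator g p else Aᶜ.indicator 1 p
  have hφ : ∀ m s i, Measurable (φ m s i) := by
    intro m s i
    simp only [φ]
    split_ifs
    · exact measurable_one.indicator hA
    · exact hg.indicator hA.compl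
    · exact measurable_one.indicator hA.compl
  have hint : ∀ m s, s < m → ∫⁻ ω, ∏ i ∈ Finset.range (m + 1), φ m s i (ω i) ∂μ
      = γ * ν Aᶜ ^ (m - 1) * ν A := by
    intro m s hs
    rw [lintegral_prod_range_infinitePi (hφ m s), Finset.prod_range_succ,
      ← Finset.mul_prod_erase _ _ (Finset.mem_range.2 hs)]
    have e1 : ∫⁻ p, φ m s s p ∂ν = γ := by
      simp only [φ, hs.ne, if_true, if_false, γ]
      exact lintegral_indicator hA.compl g
    have e2 : ∫⁻ p, φ m s m p ∂ν = ν A := by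
      simp only [φ, if_true]
      exact lintegral_indicator_one hA
    have e3 : ∏ i ∈ (Finset.range m).erase s, ∫⁻ p, φ m s i p ∂ν = ν Aᶜ ^ (m - 1) := by
      rw [Finset.prod_congr rfl (g := fun _ => ν Aᶜ)]
      · simp [Finset.card_erase_of_mem (Finset.mem_range.2 hs)]
      · intro i hi
        rw [Finset.mem_erase, Finset.mem_range] at hi
        simp only [φ, hi.1, hi.2.ne, if_false]
        exact lintegral_indicator_one hA.compl
    rw [e1, e2, e3]
  have hpt : ∀ ω : ℕ → P, (firstHit A ω : ℝ≥0∞) ^ j * ∑ s ∈ Finset.range (firstHit A ω), g (ω s)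
      ≤ ∑' m : ℕ, (m : ℝ≥0∞) ^ j * ∑ s ∈ Finset.range m,
          ∏ i ∈ Finset.range (m + 1), φ m s i (ω i) := by
    intro ω
    rcases Set.eq_empty_or_nonempty {n | ω n ∈ A} with he | hne
    -- Without any success the default value 0 makes the sum empty.
    · simp [firstHit, he]
    · refine le_trans (le_of_eq ?_) (ENNReal.le_tsum (firstHit A ω))
      congr 1
      refine Finset.sum_congr rfl fun s hs => ?_
      rw [Finset.mem_range] at hs
      have hhit : ω (firstHit A ω) ∈ A := Nat.sInf_mem hne
      have hmiss : ∀ i < firstHit A ω, ω i ∈ Aᶜ := fun i hi => Nat.notMem_of_lt_sInf hi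
      rw [Finset.prod_range_succ, ← Finset.mul_prod_erase _ _ (Finset.mem_range.2 hs),
        Finset.prod_eq_one (s := (Finset.range _).erase s)]
      · simp [φ, hs.ne, hhit, hmiss s hs]
      · intro i hi
        rw [Finset.mem_erase, Finset.mem_range] at hi
        simp [φ, hi.1, hi.2.ne, hmiss i hi.2]
  calc _ ≤ ∫⁻ ω, ∑' m : ℕ, (m : ℝ≥0∞) ^ j * ∑ s ∈ Finset.range m,
          ∏ i ∈ Finset.range (m + 1), φ m s i (ω i) ∂μ := lintegral_mono hpt
    _ = ∑' m : ℕ, (m : ℝ≥0∞) ^ j * (m * (γ * ν Aᶜ ^ (m - 1) * ν A)) := by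
        have hmeas : ∀ m s, Measurable fun ω : ℕ → P =>
            ∏ i ∈ Finset.range (m + 1), φ m s i (ω i) := fun m s =>
          Finset.measurable_prod _ fun i _ => (hφ m s i).comp (measurable_pi_apply i)
        rw [lintegral_tsum fun m => ((Finset.measurable_sum _ fun s _ =>
          hmeas m s).const_mul _).aemeasurable]
        refine tsum_congr fun m => ?_
        rw [lintegral_const_mul _ (Finset.measurable_sum _ fun s _ => hmeas m s),
          lintegral_finsetSum _ fun s _ => hmeas m s,
          Finset.sum_congr rfl fun s hs => hint m s (Finset.mem_range.1 hs)]
        simp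
    _ = γ * (ν A * ∑' n : ℕ, ((n : ℝ≥0∞) + 1) ^ (j + 1) * ν Aᶜ ^ n) := by
        -- The term m = 0 vanishes. With m = n + 1, the m choices of s raise the exponent to j + 1,
        -- and the failure at s, already counted in γ, leaves the power n of ν(Aᶜ).
        rw [tsum_eq_zero_add' ENNReal.summable]
        simp only [Nat.cast_zero, zero_mul, mul_zero, zero_add, Nat.cast_add, Nat.cast_one,
          Nat.add_sub_cancel]
        rw [← ENNReal.tsum_mul_left, ← ENNReal.tsum_mul_left]
        refine tsum_congr fun n => ?_
        ring
    _ ≤ γ * ((j + 1).factorial * (ν A)⁻¹ ^ (j + 1)) := by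
        refine mul_le_mul_right ?_ _
        exact tsum_pow_mul_geometric_le (prob_add_prob_compl hA) h (j + 1)
    _ = _ := by ring

/-- Prepending an independent term to an i.i.d. sequence gives an i.i.d. sequence. -/
lemma measurePreserving_cons_infinitePi :
    MeasurePreserving (fun z : P × (ℕ → P) => fun n : ℕ => Nat.casesOn n z.1 z.2)
      (ν.prod (Measure.infinitePi fun _ : ℕ => ν)) (Measure.infinitePi fun _ : ℕ => ν) := by
  have hm : Measurable (fun z : P × (ℕ → P) => (fun n : ℕ => Nat.casesOn n z.1 z.2 : ℕ → P)) := by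
    refine measurable_pi_lambda _ fun n => ?_
    cases n with
    | zero => exact measurable_fst
    | succ n => exact (measurable_pi_apply n).comp measurable_snd
  refine ⟨hm, Measure.eq_infinitePi _ fun s t ht => ?_⟩
  classical
  obtain ⟨n, hn⟩ := s.exists_nat_subset_range
  -- Fill the cylinder up with trivial constraints to an initial segment of coordinates, so that
  -- removing coordinate 0 is a shift.
  let t' : ℕ → Set P := fun i => if i ∈ s then t i else Set.univ
  have ht' : ∀ i, MeasurableSet (t' i) := fun i => by
    simp only [t']; split_ifs
    · exact ht i
    · exact MeasurableSet.univ
  have hpre : (fun z : P × (ℕ → P) => (fun n : ℕ => Nat.casesOn n z.1 z.2 : ℕ → P)) ⁻¹'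
      ((s : Set ℕ).pi t) = t' 0 ×ˢ ((Finset.range n : Set ℕ).pi fun i => t' (i + 1)) := by
    ext ⟨p, ω⟩
    simp only [Set.mem_preimage, Set.mem_pi, Finset.mem_coe, Set.mem_prod, Finset.mem_range, t']
    constructor
    · intro h
      refine ⟨?_, fun i _ => ?_⟩
      · split_ifs with h0
        · exact h 0 h0
        · trivial
      · split_ifs with h0
        · exact h (i + 1) h0
        · trivial
    · rintro ⟨h1, h2⟩ i hi
      cases i with
      | zero => simpa [hi] using h1
      | succ i =>
        have := h2 i (by have := Finset.mem_range.1 (hn hi); omega)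
        simpa [hi] using this
  rw [Measure.map_apply hm (MeasurableSet.pi s.countable_toSet fun i _ => ht i), hpre,
    Measure.prod_prod, Measure.infinitePi_pi _ fun i _ => ht' (i + 1), mul_comm,
    ← Finset.prod_range_succ' (fun i => ν (t' i)) n]
  have hsub : s ⊆ Finset.range (n + 1) := hn.trans (Finset.range_subset_range.2 n.le_succ)
  rw [← Finset.prod_subset hsub (f := fun i => ν (t' i))]
  · exact Finset.prod_congr rfl fun i hi => by simp [t', hi]
  · intro i _ hi; simp [t', hi]

end Geometric

section Coupling

variable {𝕏 : Type*} {N : ℕ} {w : 𝕏 → ℝ}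

/-! ### Pathwise description of the coupled chains. -/

section Pathwise

/-- The successive proposals, with their uniform variables, made to the `x`-chain. -/
def proposal (ζ : Noise 𝕏 N) (n : ℕ) : (Fin N → 𝕏) × unitInterval :=
  Nat.casesOn n (ζ.2.1, ζ.2.2.1) ζ.2.2.2

/-- The proposals that are accepted from the state `x`. -/
def acceptSet (w : 𝕏 → ℝ) (x : Fin N → 𝕏) : Set ((Fin N → 𝕏) × unitInterval) :=
  {p | (p.2 : ℝ) < avgWeight w p.1 / avgWeight w x}

/-- The number of proposals rejected by the `x`-chain before its first acceptance. -/
noncomputable def rejections (w : 𝕏 → ℝ) (ζ : Noise 𝕏 N) : ℕ :=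
  firstHit (acceptSet w ζ.1) (proposal ζ)

/-- The noises for which the coupling behaves regularly. -/
structure Regular (w : 𝕏 → ℝ) (ζ : Noise 𝕏 N) : Prop where
  pos_init : 0 < avgWeight w ζ.1
  pos_proposal : ∀ n, 0 < avgWeight w (proposal ζ n).1
  lt_one : ∀ n, ((proposal ζ n).2 : ℝ) < 1
  accepts : ∃ n, proposal ζ n ∈ acceptSet w ζ.1

/-- A rejection at a uniform variable below 1 forces the proposal to be strictly lighter than x₀. So
as long as x is frozen, every state that y can occupy is a rejected, hence lighter, proposal. The
shift is built into `proposal`: its term 0 is y₀, which is also the start of the y-chain. -/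
lemma Regular.laggedPair_of_lt {ζ : Noise 𝕏 N} (h : Regular w ζ) {k : ℕ}
    (hk : k < rejections w ζ) :
    xChain w ζ (k + 1) = ζ.1 ∧ avgWeight w (yChain w ζ k) < avgWeight w ζ.1 ∧
      ∃ i ≤ k, yChain w ζ k = (proposal ζ i).1 := by
  have hrej : ∀ k, k < rejections w ζ →
      ¬ ((proposal ζ k).2 : ℝ) < avgWeight w (proposal ζ k).1 / avgWeight w ζ.1 ∧
      avgWeight w (proposal ζ k).1 < avgWeight w ζ.1 := by
    intro k hk
    have h1 : ¬ ((proposal ζ k).2 : ℝ) < avgWeight w (proposal ζ k).1 / avgWeight w ζ.1 :=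
      fun hmem => Nat.notMem_of_lt_sInf (m := k) hk hmem
    refine ⟨h1, ?_⟩
    have := (not_lt.1 h1).trans_lt (h.lt_one k)
    rwa [div_lt_one h.pos_init] at this
  induction k with
  | zero =>
    have h0 := hrej 0 hk
    refine ⟨?_, h0.2, 0, le_rfl, rfl⟩
    simp only [xChain, laggedPair, pimhMove]
    exact if_neg h0.1
  | succ k ih =>
    obtain ⟨ih1, ih2, i, hi, hy⟩ := ih (by omega)
    have hr := hrej (k + 1) hk
    have hx : xChain w ζ (k + 1 + 1) = pimhMove w (xChain w ζ (k + 1)) (proposal ζ (k + 1)).1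
      (proposal ζ (k + 1)).2 := rfl
    have hyy : yChain w ζ (k + 1) = pimhMove w (yChain w ζ k) (proposal ζ (k + 1)).1
      (proposal ζ (k + 1)).2 := rfl
    refine ⟨?_, ?_⟩
    · rw [hx, ih1, pimhMove, if_neg hr.1]
    · rw [hyy, pimhMove]
      split_ifs
      · exact ⟨hr.2, k + 1, le_rfl, rfl⟩
      · exact ⟨ih2, i, by omega, hy⟩

/-- The state y is lighter than x₀, so its acceptance threshold is larger and it follows x onto the
accepted proposal. If nothing is rejected, x moves directly to y₀. -/
lemma Regular.xChain_eq_yChain {ζ : Noise 𝕏 N} (h : Regular w ζ) :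
    xChain w ζ (rejections w ζ + 1) = yChain w ζ (rejections w ζ) := by
  have hacc : ((proposal ζ (rejections w ζ)).2 : ℝ) <
      avgWeight w (proposal ζ (rejections w ζ)).1 / avgWeight w ζ.1 :=
    Nat.sInf_mem (s := {n | proposal ζ n ∈ acceptSet w ζ.1}) h.accepts
  rcases hK : rejections w ζ with _ | k
  · rw [hK] at hacc
    simp only [xChain, yChain, laggedPair, pimhMove]
    exact if_pos hacc
  · rw [hK] at hacc
    obtain ⟨h1, h2, i, hi, hy⟩ := h.laggedPair_of_lt (k := k) (by omega)
    have hx : xChain w ζ (k + 1 + 1) = pimhMove w (xChain w ζ (k + 1)) (proposal ζ (k + 1)).1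
      (proposal ζ (k + 1)).2 := rfl
    have hyy : yChain w ζ (k + 1) = pimhMove w (yChain w ζ k) (proposal ζ (k + 1)).1
      (proposal ζ (k + 1)).2 := rfl
    rw [hx, hyy, h1, pimhMove, pimhMove, if_pos hacc, if_pos]
    refine hacc.trans_le ?_
    have p1 := h.pos_proposal (k + 1)
    have p2 := h.pos_proposal i
    rw [← hy] at p2
    gcongr

lemma Regular.meetingTime_eq {ζ : Noise 𝕏 N} (h : Regular w ζ) :
    meetingTime w ζ = ((rejections w ζ + 1 : ℕ) : ℕ∞) := by
  refine le_antisymm (iInf₂_le (rejections w ζ) h.xChain_eq_yChain)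
    (le_iInf₂ fun k hk => ?_)
  by_contra hlt
  rw [not_le, Nat.cast_lt] at hlt
  obtain ⟨h1, h2, -⟩ := h.laggedPair_of_lt (k := k) (by omega)
  rw [h1] at hk
  -- The strict inequality between the weights excludes an earlier meeting.
  exact h2.ne' (congrArg _ hk)

lemma Regular.uisCost_eq {ζ : Noise 𝕏 N} (h : Regular w ζ) :
    uisCost w ζ = N * (2 + rejections w ζ) := by
  rw [uisCost, h.meetingTime_eq, ENat.toNat_natCast]
  push_cast; ring

lemma Regular.uisEstimator_eq {ζ : Noise 𝕏 N} (h : Regular w ζ) (f : 𝕏 → ℝ) :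
    uisEstimator w f ζ = isEstimator w f ζ.1 + ∑ k ∈ Finset.range (rejections w ζ),
      (isEstimator w f ζ.1 - isEstimator w f (yChain w ζ k)) := by
  rw [uisEstimator, h.meetingTime_eq, ENat.toNat_natCast, Nat.add_sub_cancel]
  congr 1
  refine Finset.sum_congr rfl fun k hk => ?_
  rw [(h.laggedPair_of_lt (Finset.mem_range.1 hk)).1]

/-- Cauchy–Schwarz over the K differences. Which proposal y_k equals depends on the past, so its
squared error is bounded by the sum over all rejected proposals; this costs one more factor K but
leaves the form K^j Σ_{s<K} Γ that the geometric moment bound handles. -/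
lemma Regular.sq_uisEstimator_sub_le {ζ : Noise 𝕏 N} (h : Regular w ζ) (f : 𝕏 → ℝ) (c : ℝ) :
    (uisEstimator w f ζ - isEstimator w f ζ.1) ^ 2 ≤
      2 * ((rejections w ζ : ℝ) ^ 1 * ∑ _s ∈ Finset.range (rejections w ζ),
        (isEstimator w f ζ.1 - c) ^ 2) +
      2 * ((rejections w ζ : ℝ) ^ 2 * ∑ s ∈ Finset.range (rejections w ζ),
        (isEstimator w f (proposal ζ s).1 - c) ^ 2) := by
  rw [h.uisEstimator_eq, add_sub_cancel_left]
  set K := rejections w ζ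
  set S := ∑ s ∈ Finset.range K, (isEstimator w f (proposal ζ s).1 - c) ^ 2
  have hk : ∀ k ∈ Finset.range K, (isEstimator w f ζ.1 - isEstimator w f (yChain w ζ k)) ^ 2 ≤
      2 * (isEstimator w f ζ.1 - c) ^ 2 + 2 * S := by
    intro k hk
    have hk' := Finset.mem_range.1 hk
    obtain ⟨-, -, i, hi, hy⟩ := h.laggedPair_of_lt hk'
    rw [hy]
    have hS : (isEstimator w f (proposal ζ i).1 - c) ^ 2 ≤ S :=
      Finset.single_le_sum (f := fun s => (isEstimator w f (proposal ζ s).1 - c) ^ 2)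
        (fun s _ => sq_nonneg _) (Finset.mem_range.2 (hi.trans_lt hk'))
    nlinarith [sq_nonneg ((isEstimator w f ζ.1 - c) + (isEstimator w f (proposal ζ i).1 - c))]
  calc _ ≤ (K : ℝ) * ∑ k ∈ Finset.range K,
        (isEstimator w f ζ.1 - isEstimator w f (yChain w ζ k)) ^ 2 := by
        simpa using sq_sum_le_card_mul_sum_sq (s := Finset.range K)
          (f := fun k => isEstimator w f ζ.1 - isEstimator w f (yChain w ζ k))
    _ ≤ (K : ℝ) * ∑ k ∈ Finset.range K, (2 * (isEstimator w f ζ.1 - c) ^ 2 + 2 * S) := by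
        gcongr with k hk'; exact hk k hk'
    _ = _ := by simp only [Finset.sum_const, Finset.card_range, nsmul_eq_mul]; ring

end Pathwise

/-! ### Measurability of the chains and of the rejection count. -/

section Measurability

variable [MeasurableSpace 𝕏]

@[fun_prop]
lemma measurable_proposal (n : ℕ) : Measurable (fun ζ : Noise 𝕏 N => proposal ζ n) := by
  cases n with
  | zero =>
    exact (measurable_fst.comp measurable_snd).prodMk
      (measurable_fst.comp (measurable_snd.comp measurable_snd))
  | succ n =>
    exact (measurable_pi_apply n).comp
      (measurable_snd.comp (measurable_snd.comp measurable_snd))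

lemma measurableSet_accept (hw : Measurable w) :
    MeasurableSet {z : (Fin N → 𝕏) × ((Fin N → 𝕏) × unitInterval) | z.2 ∈ acceptSet w z.1} := by
  have h1 : Measurable fun z : (Fin N → 𝕏) × ((Fin N → 𝕏) × unitInterval) => (z.2.2 : ℝ) :=
    measurable_subtype_coe.comp (measurable_snd.comp measurable_snd)
  have h2 : Measurable fun z : (Fin N → 𝕏) × ((Fin N → 𝕏) × unitInterval) =>
      avgWeight w z.2.1 / avgWeight w z.1 :=
    ((measurable_avgWeight hw).comp (measurable_fst.comp measurable_snd)).div
      ((measurable_avgWeight hw).comp measurable_fst)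
  exact measurableSet_lt h1 h2

lemma measurableSet_acceptSet (hw : Measurable w) (x : Fin N → 𝕏) :
    MeasurableSet (acceptSet w x) :=
  measurable_prodMk_left (x := x) (measurableSet_accept hw)

lemma measurable_rejections (hw : Measurable w) :
    Measurable (fun ζ : Noise 𝕏 N => rejections w ζ) :=
  (measurable_firstHit (measurableSet_accept (N := N) hw)).comp
    (measurable_pi_lambda (fun (ζ : Noise 𝕏 N) (n : ℕ) => (ζ.1, proposal ζ n)) fun n =>
      measurable_fst.prodMk (measurable_proposal n))

lemma measurable_pimhMove (hw : Measurable w) {α : Type*} [MeasurableSpace α]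
    {x z : α → Fin N → 𝕏} {u : α → unitInterval} (hx : Measurable x) (hz : Measurable z)
    (hu : Measurable u) : Measurable (fun a => pimhMove w (x a) (z a) (u a)) := by
  classical
  unfold pimhMove
  refine Measurable.ite ?_ hz hx
  exact measurableSet_accept (N := N) hw |>.preimage (hx.prodMk (hz.prodMk hu))

lemma measurable_yChain (hw : Measurable w) (k : ℕ) :
    Measurable (fun ζ : Noise 𝕏 N => yChain w ζ k) := by
  induction k with
  | zero => exact measurable_fst.comp measurable_snd
  | succ k ih =>
    have hp := measurable_proposal (𝕏 := 𝕏) (N := N) (k + 1)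
    exact measurable_pimhMove hw ih (measurable_fst.comp hp) (measurable_snd.comp hp)

lemma measurable_sum_range_rejections (hw : Measurable w) {φ : ℕ → Noise 𝕏 N → ℝ}
    (hφ : ∀ k, Measurable (φ k)) :
    Measurable (fun ζ : Noise 𝕏 N => ∑ k ∈ Finset.range (rejections w ζ), φ k ζ) := by
  have h : Measurable (fun z : ℕ × Noise 𝕏 N => ∑ k ∈ Finset.range z.1, φ k z.2) :=
    measurable_from_prod_countable_right fun n =>
      Finset.measurable_sum (Finset.range n) fun k _ => hφ k
  exact h.comp ((measurable_rejections hw).prodMk measurable_id)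

end Measurability

/-! ### Law of the proposals, and moments of the number of rejections. -/

section Law

variable [MeasurableSpace 𝕏] {q : Measure 𝕏} [IsProbabilityMeasure q]

/-- The law of a proposal together with its uniform variable. -/
noncomputable abbrev proposalLaw (q : Measure 𝕏) [IsProbabilityMeasure q] (N : ℕ) :
    Measure ((Fin N → 𝕏) × unitInterval) :=
  (qbar q N).prod (volume : Measure unitInterval)

/-- The pair (y₀, u₀) is distributed as the later pairs (z_t, u_t), so the proposals form one i.i.d.
sequence independent of x₀. -/
lemma measurePreserving_proposal :
    MeasurePreserving (fun ζ : Noise 𝕏 N => (ζ.1, proposal ζ)) (noiseLaw q N)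
      ((qbar q N).prod (Measure.infinitePi fun _ : ℕ => proposalLaw q N)) := by
  have h1 := (measurePreserving_prodAssoc (qbar q N) (volume : Measure unitInterval)
    (Measure.infinitePi fun _ : ℕ => proposalLaw q N)).symm
  have h2 := (measurePreserving_cons_infinitePi (ν := proposalLaw q N)).comp h1
  exact (MeasurePreserving.id (qbar q N)).prod h2

lemma measurePreserving_fst_noiseLaw :
    MeasurePreserving (fun ζ : Noise 𝕏 N => ζ.1) (noiseLaw q N) (qbar q N) :=
  measurePreserving_fst

instance : IsProbabilityMeasure (noiseLaw q N) := by
  unfold noiseLaw; infer_instance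

lemma volume_lt_ge {s : ℝ} (hs : 0 ≤ s) :
    ENNReal.ofReal (min 1 s) ≤ volume {u : unitInterval | (u : ℝ) < s} := by
  have hI : min 1 s ∈ unitInterval := ⟨by positivity, min_le_left _ _⟩
  have := unitInterval.volume_Iio (x := ⟨min 1 s, hI⟩)
  rw [← this]
  exact measure_mono fun u hu => lt_of_lt_of_le (show (u : ℝ) < min 1 s from hu) (min_le_right _ _)

lemma volume_not_lt_le {s : ℝ} (hs : 0 ≤ s) :
    volume {u : unitInterval | ¬ (u : ℝ) < s} ≤ ENNReal.ofReal (1 - s) := by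
  rcases le_or_gt s 1 with h | h
  · have := unitInterval.volume_Ici (x := ⟨s, hs, h⟩)
    rw [← this]
    exact measure_mono fun u hu => not_lt.1 hu
  · have : {u : unitInterval | ¬ (u : ℝ) < s} = ∅ :=
      Set.eq_empty_of_forall_notMem fun u hu => hu (u.2.2.trans_lt h)
    rw [this]; simp

lemma ae_avgWeight_pos (hpos : ∀ᵐ x ∂q, 0 < w x) (hN : 1 ≤ N) :
    ∀ᵐ x ∂(qbar q N), 0 < avgWeight w x := by
  filter_upwards [ae_qbar_forall hpos N] with x hx
  have : Nonempty (Fin N) := ⟨⟨0, hN⟩⟩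
  have : (0 : ℝ) < N := by exact_mod_cast hN
  exact mul_pos (by positivity) (Finset.sum_pos (fun i _ => hx i) Finset.univ_nonempty)

lemma integrable_min_one (hw : Measurable w) (hpos : ∀ᵐ x ∂q, 0 < w x) :
    Integrable (fun x => min 1 (w x)) q := by
  refine Integrable.of_bound (measurable_const.min hw).aestronglyMeasurable 1 ?_
  filter_upwards [hpos] with x hx
  rw [Real.norm_eq_abs, abs_of_nonneg (by positivity)]
  exact min_le_left _ _

lemma integral_min_one_pos (hw : Measurable w) (hpos : ∀ᵐ x ∂q, 0 < w x) :
    0 < ∫ x, min 1 (w x) ∂q := by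
  rw [integral_pos_iff_support_of_nonneg_ae _ (integrable_min_one hw hpos)]
  · have : Function.support (fun x => min 1 (w x)) =ᵐ[q] Set.univ := by
      refine eventuallyEq_univ.2 ?_
      filter_upwards [hpos] with x hx
      exact (lt_min one_pos hx).ne'
    rw [measure_congr this]; simp
  · filter_upwards [hpos] with x hx
    exact (lt_min one_pos hx).le

/-- Concavity of min(1, ·): the average of min(1, w) is at most min(1, Ẑ). This gives a lower bound
that is uniform in N. -/
lemma ofReal_integral_min_one_le (hw : Measurable w) (hpos : ∀ᵐ x ∂q, 0 < w x) (hN : 1 ≤ N) :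
    ENNReal.ofReal (∫ x, min 1 (w x) ∂q) ≤
      ∫⁻ x, ENNReal.ofReal (min 1 (avgWeight w x)) ∂(qbar q N) := by
  have hN0 : (0 : ℝ) < N := by exact_mod_cast hN
  have hi := integrable_min_one hw hpos
  have hci : ∀ i : Fin N, Integrable (fun x : Fin N → 𝕏 => min 1 (w (x i))) (qbar q N) := fun i =>
    (measurePreserving_coord N i).integrable_comp_of_integrable hi
  have h1 : ∫ x, avgWeight (fun t => min 1 (w t)) x ∂(qbar q N) = ∫ x, min 1 (w x) ∂q := by
    simp only [avgWeight]
    have hc : ∀ i : Fin N, ∫ x : Fin N → 𝕏, min 1 (w (x i)) ∂(qbar q N) = ∫ x, min 1 (w x) ∂q :=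
      fun i => integral_comp_eval (μ := fun _ : Fin N => q) (f := fun x => min 1 (w x)) hi.1
    rw [integral_const_mul, integral_finsetSum _ fun i _ => hci i,
      Finset.sum_congr rfl fun i _ => hc i]
    simp; field_simp
  have h1i : Integrable (fun x : Fin N → 𝕏 => avgWeight (fun t => min 1 (w t)) x) (qbar q N) :=
    (integrable_finsetSum _ fun i _ => hci i).const_mul _
  rw [← h1, ofReal_integral_eq_lintegral_ofReal h1i]
  · refine lintegral_mono fun x => ENNReal.ofReal_le_ofReal (le_min ?_ ?_)
    · rw [avgWeight, inv_mul_le_iff₀ hN0, mul_one]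
      calc _ ≤ ∑ _n : Fin N, (1 : ℝ) := Finset.sum_le_sum fun i _ => min_le_left _ _
        _ = N := by simp
    · simp only [avgWeight]
      gcongr
      exact min_le_right _ _
  · filter_upwards [ae_qbar_forall hpos N] with x hx
    have : ∀ i, 0 < min 1 (w (x i)) := fun i => lt_min one_pos (hx i)
    exact mul_nonneg (by positivity) (Finset.sum_nonneg fun i _ => (this i).le)

/-- Follows from min(1, b/a) ≥ min(1, b) / max(1, a) and the uniform bound on the mean of min(1, Ẑ).
-/
lemma ofReal_le_proposalLaw_acceptSet (hw : Measurable w) (hpos : ∀ᵐ x ∂q, 0 < w x) (hN : 1 ≤ N)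
    {x : Fin N → 𝕏} (hx : 0 < avgWeight w x) :
    ENNReal.ofReal ((∫ t, min 1 (w t) ∂q) / max 1 (avgWeight w x)) ≤
      proposalLaw q N (acceptSet w x) := by
  rw [Measure.prod_apply (measurableSet_acceptSet hw x), div_eq_inv_mul,
    ENNReal.ofReal_mul (by positivity)]
  calc _ ≤ ENNReal.ofReal (max 1 (avgWeight w x))⁻¹ *
        ∫⁻ z, ENNReal.ofReal (min 1 (avgWeight w z)) ∂(qbar q N) := by
        gcongr; exact ofReal_integral_min_one_le hw hpos hN
    _ = ∫⁻ z, ENNReal.ofReal (max 1 (avgWeight w x))⁻¹ *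
        ENNReal.ofReal (min 1 (avgWeight w z)) ∂(qbar q N) := by
        rw [lintegral_const_mul _ (by fun_prop)]
    _ ≤ _ := by
        refine lintegral_mono_ae ?_
        filter_upwards [ae_avgWeight_pos hpos hN] with z hz
        refine le_trans ?_ (volume_lt_ge (by positivity : 0 ≤ avgWeight w z / avgWeight w x))
        rw [← ENNReal.ofReal_mul (by positivity)]
        refine ENNReal.ofReal_le_ofReal ?_
        rw [inv_mul_le_iff₀ (by positivity), mul_min_of_nonneg _ _ (by positivity)]
        refine min_le_min ?_ ?_
        · rw [mul_one]; exact le_max_left _ _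
        · calc avgWeight w z = avgWeight w x * (avgWeight w z / avgWeight w x) := by field_simp
            _ ≤ _ := by gcongr; exact le_max_right _ _

lemma lintegral_compl_acceptSet_le (hw : Measurable w) (hpos : ∀ᵐ x ∂q, 0 < w x) (hN : 1 ≤ N)
    {x : Fin N → 𝕏} (hx : 0 < avgWeight w x) {Γ : (Fin N → 𝕏) → ℝ≥0∞} (hΓ : Measurable Γ) :
    ∫⁻ p in (acceptSet w x)ᶜ, Γ p.1 ∂(proposalLaw q N) ≤
      ∫⁻ z, ENNReal.ofReal (1 - avgWeight w z / avgWeight w x) * Γ z ∂(qbar q N) := by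
  have hA := (measurableSet_acceptSet hw x).compl
  have hm : Measurable ((acceptSet w x)ᶜ.indicator
      fun p : (Fin N → 𝕏) × unitInterval => Γ p.1) := (hΓ.comp measurable_fst).indicator hA
  rw [← lintegral_indicator hA, lintegral_prod _ hm.aemeasurable]
  refine lintegral_mono_ae ?_
  filter_upwards [ae_avgWeight_pos hpos hN] with z hz
  have hs : MeasurableSet {u : unitInterval | ¬ (u : ℝ) < avgWeight w z / avgWeight w x} :=
    (measurableSet_lt measurable_subtype_coe measurable_const).compl
  have : ∀ u : unitInterval, (acceptSet w x)ᶜ.indicator (fun p => Γ p.1) (z, u) =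
      {u : unitInterval | ¬ (u : ℝ) < avgWeight w z / avgWeight w x}.indicator
        (fun _ => Γ z) u := fun u => rfl
  simp_rw [this]
  rw [lintegral_indicator hs, lintegral_const, Measure.restrict_apply_univ, mul_comm]
  gcongr
  exact volume_not_lt_le (by positivity)

lemma ae_regular (hw : Measurable w) (hpos : ∀ᵐ x ∂q, 0 < w x) (hN : 1 ≤ N) :
    ∀ᵐ ζ ∂(noiseLaw q N), Regular w ζ := by
  have hseq : ∀ n, MeasurePreserving (fun ζ : Noise 𝕏 N => proposal ζ n) (noiseLaw q N)
      (proposalLaw q N) := fun n =>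
    (measurePreserving_eval_infinitePi (fun _ : ℕ => proposalLaw q N) n).comp
      (measurePreserving_snd.comp measurePreserving_proposal)
  have h1 := measurePreserving_fst_noiseLaw.quasiMeasurePreserving.ae
    (ae_avgWeight_pos (N := N) hpos hN)
  have h2 : ∀ᵐ ζ ∂(noiseLaw q N), ∀ n, 0 < avgWeight w (proposal ζ n).1 := ae_all_iff.2 fun n =>
    (measurePreserving_fst.comp (hseq n)).quasiMeasurePreserving.ae (ae_avgWeight_pos hpos hN)
  have hu : ∀ᵐ u : unitInterval, (u : ℝ) < 1 := by
    have : ∀ᵐ u : unitInterval, u ≠ 1 := by simp [ae_iff]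
    filter_upwards [this] with u hu
    exact lt_of_le_of_ne u.2.2 fun h => hu (Subtype.ext h)
  have h3 : ∀ᵐ ζ ∂(noiseLaw q N), ∀ n, ((proposal ζ n).2 : ℝ) < 1 := ae_all_iff.2 fun n =>
    (measurePreserving_snd.comp (hseq n)).quasiMeasurePreserving.ae hu
  have h4 : ∀ᵐ ζ ∂(noiseLaw q N), ∃ n, proposal ζ n ∈ acceptSet w ζ.1 := by
    refine measurePreserving_proposal.quasiMeasurePreserving.ae
      (p := fun z => ∃ n, z.2 n ∈ acceptSet w z.1) ?_
    have hm : MeasurableSet {z : (Fin N → 𝕏) × (ℕ → (Fin N → 𝕏) × unitInterval) |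
        ∃ n, z.2 n ∈ acceptSet w z.1} := by
      simp only [Set.ofPred_exists]
      refine MeasurableSet.iUnion fun n => ?_
      exact (measurableSet_accept hw).preimage
        (measurable_fst.prodMk ((measurable_pi_apply n).comp measurable_snd))
    rw [Measure.ae_prod_iff_ae_ae hm]
    filter_upwards [ae_avgWeight_pos (N := N) hpos hN] with x hx
    refine ae_exists_mem_infinitePi (measurableSet_acceptSet hw x) ?_
    refine ne_of_gt (lt_of_lt_of_le ?_ (ofReal_le_proposalLaw_acceptSet hw hpos hN hx))
    have := integral_min_one_pos hw hpos
    rw [ENNReal.ofReal_pos]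
    positivity
  filter_upwards [h1, h2, h3, h4] with ζ a b c d using ⟨a, b, c, d⟩

/-- Condition on x₀ and apply the geometric moment bound, with the acceptance probability bounded
below and the rejection probability of each z bounded above. What remains is an integral over two
independent samples. -/
lemma lintegral_rejections_le (hw : Measurable w) (hpos : ∀ᵐ x ∂q, 0 < w x) (hN : 1 ≤ N)
    {Γ : (Fin N → 𝕏) × (Fin N → 𝕏) → ℝ≥0∞} (hΓ : Measurable Γ) (j : ℕ) :
    ∫⁻ ζ, (rejections w ζ : ℝ≥0∞) ^ j * ∑ s ∈ Finset.range (rejections w ζ),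
        Γ (ζ.1, (proposal ζ s).1) ∂(noiseLaw q N) ≤
      (j + 1).factorial * ∫⁻ z, ENNReal.ofReal
        ((max 1 (avgWeight w z.1) / ∫ t, min 1 (w t) ∂q) ^ (j + 1) *
          (1 - avgWeight w z.2 / avgWeight w z.1)) * Γ z ∂((qbar q N).prod (qbar q N)) := by
  set c₀ := ∫ t, min 1 (w t) ∂q
  have hc : 0 < c₀ := integral_min_one_pos hw hpos
  have hT : Measurable fun z : (Fin N → 𝕏) × (ℕ → (Fin N → 𝕏) × unitInterval) =>
      firstHit (acceptSet w z.1) z.2 :=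
    (measurable_firstHit (measurableSet_accept (N := N) hw)).comp
      (measurable_pi_lambda (fun (z : (Fin N → 𝕏) × (ℕ → (Fin N → 𝕏) × unitInterval)) (n : ℕ) =>
        (z.1, z.2 n)) fun n => by fun_prop)
  have hS : Measurable fun z : (Fin N → 𝕏) × (ℕ → (Fin N → 𝕏) × unitInterval) =>
      ∑ s ∈ Finset.range (firstHit (acceptSet w z.1) z.2), Γ (z.1, (z.2 s).1) := by
    have h : Measurable (fun z : ℕ × ((Fin N → 𝕏) × (ℕ → (Fin N → 𝕏) × unitInterval)) =>
        ∑ s ∈ Finset.range z.1, Γ (z.2.1, (z.2.2 s).1)) :=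
      measurable_from_prod_countable_right fun n =>
        Finset.measurable_sum (Finset.range n) fun k _ => by fun_prop
    exact h.comp (hT.prodMk measurable_id)
  have hTc : Measurable fun z : (Fin N → 𝕏) × (ℕ → (Fin N → 𝕏) × unitInterval) =>
      (firstHit (acceptSet w z.1) z.2 : ℝ≥0∞) := (measurable_of_countable _).comp hT
  have hm : Measurable fun z : (Fin N → 𝕏) × (ℕ → (Fin N → 𝕏) × unitInterval) =>
      (firstHit (acceptSet w z.1) z.2 : ℝ≥0∞) ^ j *
        ∑ s ∈ Finset.range (firstHit (acceptSet w z.1) z.2), Γ (z.1, (z.2 s).1) :=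
    (hTc.pow_const j).mul hS
  have e := (measurePreserving_proposal (q := q) (N := N)).lintegral_comp hm
  change ∫⁻ ζ, (rejections w ζ : ℝ≥0∞) ^ j * ∑ s ∈ Finset.range (rejections w ζ),
        Γ (ζ.1, (proposal ζ s).1) ∂(noiseLaw q N) = _ at e
  rw [e, lintegral_prod _ hm.aemeasurable, lintegral_prod _ (by fun_prop),
    ← lintegral_const_mul' _ _ (ENNReal.natCast_ne_top _)]
  refine lintegral_mono_ae ?_
  filter_upwards [ae_avgWeight_pos (N := N) hpos hN] with x hx
  have hA := ofReal_le_proposalLaw_acceptSet hw hpos hN hx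
  have hr : 0 < c₀ / max 1 (avgWeight w x) := by positivity
  have hA0 : proposalLaw q N (acceptSet w x) ≠ 0 :=
    ne_of_gt (lt_of_lt_of_le (ENNReal.ofReal_pos.2 hr) hA)
  have hΓx : Measurable fun z => Γ (x, z) := hΓ.comp measurable_prodMk_left
  refine (lintegral_firstHit_le (measurableSet_acceptSet hw x) hA0
    (hΓx.comp measurable_fst) j).trans ?_
  have hinv : (proposalLaw q N (acceptSet w x))⁻¹ ≤
      ENNReal.ofReal (max 1 (avgWeight w x) / c₀) := by
    refine (ENNReal.inv_le_inv.2 hA).trans_eq ?_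
    rw [← ENNReal.ofReal_inv_of_pos hr, inv_div]
  calc _ ≤ ((j + 1).factorial : ℝ≥0∞) *
        (∫⁻ z, ENNReal.ofReal (1 - avgWeight w z / avgWeight w x) * Γ (x, z) ∂(qbar q N)) *
        ENNReal.ofReal (max 1 (avgWeight w x) / c₀) ^ (j + 1) := by
        gcongr
        exact lintegral_compl_acceptSet_le hw hpos hN hx hΓx
    _ = _ := by
        rw [mul_assoc, mul_comm (lintegral _ _), ← lintegral_const_mul' _ _ (by finiteness)]
        congr 1
        refine lintegral_congr fun z => ?_
        rw [ENNReal.ofReal_mul (by positivity), ENNReal.ofReal_pow (by positivity)]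
        ring

end Law

end Coupling

/-! ### Pointwise majorants and the low-weight event. -/

section Majorants

variable {𝕏 : Type*} {N : ℕ} {w f : 𝕏 → ℝ} {c : ℝ}

/-- The truncated fluctuation of the average weight around its mean. -/
noncomputable def deviation (w : 𝕏 → ℝ) (x : Fin N → 𝕏) : ℝ := min 1 (4 * |avgWeight w x - 1|)

/-- The indicator of a small average weight. -/
noncomputable def lowWeight (w : 𝕏 → ℝ) (x : Fin N → 𝕏) : ℝ :=
  if avgWeight w x < 1 / 2 then 1 else 0

/-- A polynomial majorant of the expected meeting time. -/
noncomputable def weightMajorant (w : 𝕏 → ℝ) (x : Fin N → 𝕏) : ℝ := max 1 (avgWeight w x) ^ 3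

/-- A majorant of the squared estimation error. -/
noncomputable def errorMajorant (w f : 𝕏 → ℝ) (c : ℝ) (x : Fin N → 𝕏) : ℝ :=
  4 * avgWeight (fun t => w t * (f t - c)) x ^ 2 + (isEstimator w f x - c) ^ 2 * lowWeight w x

lemma deviation_nonneg (x : Fin N → 𝕏) : 0 ≤ deviation w x := by unfold deviation; positivity

lemma deviation_le_one (x : Fin N → 𝕏) : deviation w x ≤ 1 := min_le_left _ _

lemma lowWeight_nonneg (x : Fin N → 𝕏) : 0 ≤ lowWeight w x := by
  unfold lowWeight; split_ifs <;> norm_num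

lemma one_le_weightMajorant (x : Fin N → 𝕏) : 1 ≤ weightMajorant w x :=
  one_le_pow₀ (le_max_left _ _)

lemma errorMajorant_nonneg (x : Fin N → 𝕏) : 0 ≤ errorMajorant w f c x :=
  add_nonneg (by positivity) (mul_nonneg (sq_nonneg _) (lowWeight_nonneg x))

section Pointwise

/-- If either deviation is truncated, the right side is at least 1. Otherwise Ẑ(x) ≥ 1/2, and
dividing Ẑ(x) - Ẑ(z) by it costs at most a factor 2. -/
lemma one_sub_div_le {x z : Fin N → 𝕏} (hx : 0 < avgWeight w x) (hz : 0 < avgWeight w z) :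
    1 - avgWeight w z / avgWeight w x ≤ deviation w x + deviation w z := by
  unfold deviation
  set a := avgWeight w x
  set b := avgWeight w z
  have hba : 0 < b / a := by positivity
  rcases le_total 1 (4 * |a - 1|) with h1 | h1
  · rw [min_eq_left h1]
    have : 0 ≤ min 1 (4 * |b - 1|) := by positivity
    linarith
  rcases le_total 1 (4 * |b - 1|) with h2 | h2
  · rw [min_eq_left h2]
    have : 0 ≤ min 1 (4 * |a - 1|) := by positivity
    linarith
  rw [min_eq_right h1, min_eq_right h2]
  have ha : 1 / 2 ≤ a := by have := neg_abs_le (a - 1); linarith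
  rw [sub_le_iff_le_add, ← sub_le_iff_le_add', le_div_iff₀ hx]
  have e1 := le_abs_self (a - 1)
  have e2 := neg_abs_le (b - 1)
  have p1 := abs_nonneg (a - 1)
  have p2 := abs_nonneg (b - 1)
  nlinarith [mul_le_mul_of_nonneg_right ha p1, mul_le_mul_of_nonneg_right ha p2]

lemma weightMajorant_le (x : Fin N → 𝕏) : weightMajorant w x ≤
    4 + 2 * (avgWeight w x - 1) ^ 2 + 2 * (avgWeight w x - 1) ^ 4 := by
  unfold weightMajorant
  set t := |avgWeight w x - 1| with ht
  have h0 : 0 ≤ t := abs_nonneg _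
  have h1 : max 1 (avgWeight w x) ≤ 1 + t :=
    max_le (by linarith) (by linarith [le_abs_self (avgWeight w x - 1)])
  have h2 : max 1 (avgWeight w x) ^ 3 ≤ (1 + t) ^ 3 := by gcongr
  have e2 : (avgWeight w x - 1) ^ 2 = t ^ 2 := (sq_abs _).symm
  have e4 : (avgWeight w x - 1) ^ 4 = t ^ 4 := by rw [ht, Even.pow_abs (by decide)]
  rw [e2, e4]
  refine h2.trans ?_
  nlinarith [sq_nonneg (t * (t - 1)), mul_nonneg (add_nonneg h0 zero_le_one) (sq_nonneg (t - 1))]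

lemma weightMajorant_mul_deviation_le (x : Fin N → 𝕏) : weightMajorant w x * deviation w x ≤
    4 * deviation w x + 2 * (avgWeight w x - 1) ^ 2 + 2 * (avgWeight w x - 1) ^ 4 := by
  have h := mul_le_mul_of_nonneg_right (weightMajorant_le (w := w) x) (deviation_nonneg (w := w) x)
  have h1 := deviation_le_one (w := w) x
  have e2 : (avgWeight w x - 1) ^ 2 * deviation w x ≤ (avgWeight w x - 1) ^ 2 :=
    mul_le_of_le_one_right (by positivity) h1
  have e4 : (avgWeight w x - 1) ^ 4 * deviation w x ≤ (avgWeight w x - 1) ^ 4 :=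
    mul_le_of_le_one_right (by positivity) h1
  nlinarith

lemma avgWeight_mul_isEstimator_sub {x : Fin N → 𝕏} (hx : 0 < avgWeight w x) :
    avgWeight w x * (isEstimator w f x - c) = avgWeight (fun t => w t * (f t - c)) x := by
  unfold avgWeight isEstimator at *
  have hs : ∑ n, w (x n) ≠ 0 := fun h => by simp [h] at hx
  have : ∑ n, w (x n) * (f (x n) - c) = ∑ n, w (x n) * f (x n) - c * ∑ n, w (x n) := by
    rw [Finset.mul_sum, ← Finset.sum_sub_distrib]
    exact Finset.sum_congr rfl fun n _ => by ring
  rw [this]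
  field_simp

/-- When Ẑ ≥ 1/2, max(1, Ẑ) ≤ 2Ẑ, and Ẑ·(F̂ - c) is the average of w(f - c). Thus two powers of the
weight are absorbed with no mixed moment of weight and error. -/
lemma sq_max_mul_le_errorMajorant {x : Fin N → 𝕏} (hx : 0 < avgWeight w x) :
    max 1 (avgWeight w x) ^ 2 * (isEstimator w f x - c) ^ 2 ≤ errorMajorant w f c x := by
  unfold errorMajorant lowWeight
  rw [← avgWeight_mul_isEstimator_sub hx]
  set a := avgWeight w x
  set G := isEstimator w f x - c
  split_ifs with h
  · rw [max_eq_left (by linarith)]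
    nlinarith [sq_nonneg (a * G)]
  · rw [not_lt] at h
    have h1 : max 1 a ≤ 2 * a := max_le (by linarith) (by linarith)
    have h2 : max 1 a ^ 2 ≤ (2 * a) ^ 2 := by gcongr
    nlinarith [mul_le_mul_of_nonneg_right h2 (sq_nonneg G)]

lemma sq_le_errorMajorant {x : Fin N → 𝕏} (hx : 0 < avgWeight w x) :
    (isEstimator w f x - c) ^ 2 ≤ errorMajorant w f c x := by
  refine le_trans ?_ (sq_max_mul_le_errorMajorant hx)
  exact le_mul_of_one_le_left (sq_nonneg _) (one_le_pow₀ (le_max_left _ _))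

lemma abs_sq_sub_sq_le {x : Fin N → 𝕏} (hx : 0 < avgWeight w x) :
    |(isEstimator w f x - c) ^ 2 - avgWeight (fun t => w t * (f t - c)) x ^ 2| ≤
      3 * (avgWeight (fun t => w t * (f t - c)) x ^ 2 * deviation w x) +
        (isEstimator w f x - c) ^ 2 * lowWeight w x := by
  unfold lowWeight deviation
  rw [← avgWeight_mul_isEstimator_sub hx]
  set a := avgWeight w x
  set G := isEstimator w f x - c
  have hG := sq_nonneg G
  have e : G ^ 2 - (a * G) ^ 2 = G ^ 2 * (1 - a ^ 2) := by ring
  split_ifs with h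
  · have h1 : 1 ≤ 4 * |a - 1| := by
      have := neg_abs_le (a - 1); linarith
    rw [min_eq_left h1, abs_le]
    constructor <;> nlinarith [sq_nonneg (a * G)]
  · rw [not_lt] at h
    rw [mul_zero, add_zero, e, abs_mul, abs_of_nonneg hG]
    -- For a ≥ 1/2 this amounts to |1 - a²| ≤ 3a² and 1 + a ≤ 12a².
    have key : |1 - a ^ 2| ≤ 3 * (a ^ 2 * min 1 (4 * |a - 1|)) := by
      rw [mul_min_of_nonneg _ _ (by positivity), mul_min_of_nonneg _ _ (by norm_num)]
      refine le_min ?_ ?_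
      · rw [abs_le]; constructor <;> nlinarith
      · have : 1 - a ^ 2 = -((a - 1) * (1 + a)) := by ring
        rw [this, abs_neg, abs_mul, abs_of_nonneg (by linarith : 0 ≤ 1 + a)]
        nlinarith [abs_nonneg (a - 1), mul_nonneg (abs_nonneg (a - 1))
          (by nlinarith : 0 ≤ 12 * a ^ 2 - (1 + a))]
    calc _ ≤ G ^ 2 * (3 * (a ^ 2 * min 1 (4 * |a - 1|))) := by gcongr
      _ = _ := by ring

/-- Cauchy–Schwarz with Σw² ≤ (Σw)². The bound is crude but free of the weights, which is what the
low-weight event requires. -/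
lemma sq_isEstimator_sub_le_sum (hN : 1 ≤ N) {x : Fin N → 𝕏} (hx : ∀ i, 0 < w (x i)) :
    (isEstimator w f x - c) ^ 2 ≤ ∑ i, (f (x i) - c) ^ 2 := by
  have : Nonempty (Fin N) := ⟨⟨0, hN⟩⟩
  have hs : 0 < ∑ i, w (x i) := Finset.sum_pos (fun i _ => hx i) Finset.univ_nonempty
  have e : (∑ i, w (x i)) * (isEstimator w f x - c) = ∑ i, w (x i) * (f (x i) - c) := by
    simp only [isEstimator, mul_sub, Finset.sum_sub_distrib, ← Finset.sum_mul]
    field_simp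
  have h1 := Finset.sum_mul_sq_le_sq_mul_sq Finset.univ (fun i => w (x i)) (fun i => f (x i) - c)
  have h2 : ∑ i, w (x i) ^ 2 ≤ (∑ i, w (x i)) ^ 2 :=
    Finset.sum_sq_le_sq_sum_of_nonneg fun i _ => (hx i).le
  rw [← e, mul_pow] at h1
  have h3 : 0 ≤ ∑ i, (f (x i) - c) ^ 2 := Finset.sum_nonneg fun i _ => sq_nonneg _
  have h4 := h1.trans (mul_le_mul_of_nonneg_right h2 h3)
  exact le_of_mul_le_mul_left h4 (by positivity)

end Pointwise

variable [MeasurableSpace 𝕏] {q : Measure 𝕏} [IsProbabilityMeasure q]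

@[fun_prop]
lemma measurable_deviation (hw : Measurable w) :
    Measurable (fun x : Fin N → 𝕏 => deviation w x) := by
  unfold deviation; fun_prop

@[fun_prop]
lemma measurable_lowWeight (hw : Measurable w) :
    Measurable (fun x : Fin N → 𝕏 => lowWeight w x) := by
  unfold lowWeight
  exact Measurable.ite (measurableSet_lt (by fun_prop) measurable_const)
    measurable_const measurable_const

@[fun_prop]
lemma measurable_weightMajorant (hw : Measurable w) :
    Measurable (fun x : Fin N → 𝕏 => weightMajorant w x) := by
  unfold weightMajorant; fun_prop

/-- Because (1 + t)(1 - t + t²) = 1 + t³ ≥ 1. -/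
lemma exp_neg_le {t : ℝ} (ht : 0 ≤ t) : Real.exp (-t) ≤ 1 - t + t ^ 2 := by
  rw [Real.exp_neg, inv_le_iff_one_le_mul₀ (Real.exp_pos t)]
  have h1 := Real.add_one_le_exp t
  have h2 : 0 ≤ 1 - t + t ^ 2 := by nlinarith [sq_nonneg (t - 1)]
  nlinarith [mul_le_mul_of_nonneg_left h1 h2, pow_nonneg ht 3]

/-- An exponential moment of a nonnegative variable of mean one, centred at `1 / 2`. -/
lemma exists_integral_exp_lt_one (hpos : ∀ᵐ x ∂q, 0 < w x)
    (hw2 : MemLp w 2 q) (hw1 : ∫ x, w x ∂q = 1) :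
    ∃ l > 0, ∫ x, Real.exp (l * (1 / 2 - w x)) ∂q < 1 := by
  set m := ∫ x, w x ^ 2 ∂q
  have hm : 0 ≤ m := integral_nonneg fun x => sq_nonneg _
  -- Chosen so that lm ≤ 1/4, which makes the final exponent -l/2 + l²m negative.
  set l : ℝ := 1 / (4 * (m + 1))
  have hl : 0 < l := by positivity
  have hwi := hw2.integrable one_le_two
  refine ⟨l, hl, ?_⟩
  have hb : Integrable (fun x => 1 - l * w x + l ^ 2 * w x ^ 2) q :=
    ((integrable_const 1).sub (hwi.const_mul l)).add (hw2.integrable_sq.const_mul (l ^ 2))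
  calc ∫ x, Real.exp (l * (1 / 2 - w x)) ∂q
      ≤ ∫ x, Real.exp (l / 2) * (1 - l * w x + l ^ 2 * w x ^ 2) ∂q := by
        refine integral_mono_of_nonneg (ae_of_all _ fun x => (Real.exp_pos _).le)
          (hb.const_mul _) ?_
        filter_upwards [hpos] with x hx
        have : l * (1 / 2 - w x) = l / 2 + -(l * w x) := by ring
        rw [this, Real.exp_add]
        have := exp_neg_le (mul_nonneg hl.le hx.le)
        rw [mul_pow] at this
        gcongr
    _ = Real.exp (l / 2) * (1 - l + l ^ 2 * m) := by
        have h1 : Integrable (fun x => 1 - l * w x) q := (integrable_const 1).sub (hwi.const_mul l)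
        rw [integral_const_mul, integral_add h1 (hw2.integrable_sq.const_mul (l ^ 2)),
          integral_sub (integrable_const 1) (hwi.const_mul l), integral_const_mul,
          integral_const_mul, hw1]
        simp [m]
    _ ≤ Real.exp (l / 2) * Real.exp (-l + l ^ 2 * m) := by
        gcongr
        have := Real.add_one_le_exp (-l + l ^ 2 * m)
        linarith
    _ < 1 := by
        rw [← Real.exp_add, Real.exp_lt_one_iff]
        have : l * (m + 1) = 1 / 4 := by simp only [l]; field_simp
        nlinarith

lemma integrable_sum_sq {g : 𝕏 → ℝ} (hg2 : MemLp g 2 q) (N : ℕ) :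
    Integrable (fun x : Fin N → 𝕏 => ∑ i, g (x i) ^ 2) (qbar q N) :=
  integrable_finsetSum _ fun i _ =>
    (measurePreserving_coord N i).integrable_comp_of_integrable hg2.integrable_sq

/-- The event of a small average weight is exponentially unlikely, even after reweighting. -/
lemma tendsto_integral_sum_sq_mul_lowWeight (hw : Measurable w) (hpos : ∀ᵐ x ∂q, 0 < w x)
    (hw2 : MemLp w 2 q) (hw1 : ∫ x, w x ∂q = 1) {g : 𝕏 → ℝ} (hg : Measurable g)
    (hg2 : MemLp g 2 q) :
    Tendsto (fun N : ℕ => N * ∫ x, (∑ i, g (x i) ^ 2) * lowWeight w x ∂(qbar q N))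
      atTop (𝓝 0) := by
  obtain ⟨l, hl, hρ1⟩ := exists_integral_exp_lt_one hpos hw2 hw1
  -- Chernoff tilt: ∏ e(xᵢ) ≥ 1 when Ẑ < 1/2, and e has mean ρ < 1. Each of the N terms g(x_j)² then
  -- contributes A·ρ^(N-1), finite because e is bounded.
  let e : 𝕏 → ℝ := fun t => Real.exp (l * (1 / 2 - w t))
  have hem : Measurable e := by fun_prop
  have he0 : ∀ t, 0 < e t := fun t => Real.exp_pos _
  have heb : ∀ᵐ t ∂q, e t ≤ Real.exp (l / 2) := by
    filter_upwards [hpos] with t ht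
    refine Real.exp_le_exp.2 ?_
    nlinarith
  have hei : Integrable e q := Integrable.of_bound hem.aestronglyMeasurable (Real.exp (l / 2)) (by
    filter_upwards [heb] with t ht
    rwa [Real.norm_eq_abs, abs_of_pos (he0 t)])
  have hgei : Integrable (fun t => g t ^ 2 * e t) q := by
    refine (hg2.integrable_sq.mul_const (Real.exp (l / 2))).mono'
      ((hg.pow_const 2).mul hem).aestronglyMeasurable ?_
    filter_upwards [heb] with t ht
    rw [Real.norm_eq_abs, abs_of_nonneg (mul_nonneg (sq_nonneg _) (he0 t).le)]
    gcongr
  set ρ := ∫ t, e t ∂q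
  have hρ0 : 0 < ρ := by
    rw [integral_pos_iff_support_of_nonneg (fun t => (he0 t).le) hei]
    have : Function.support e = Set.univ := Set.eq_univ_of_forall fun t => (he0 t).ne'
    simp [this]
  set A := ∫ t, g t ^ 2 * e t ∂q
  have hbound : ∀ N : ℕ, 1 ≤ N → ∫ x, (∑ i, g (x i) ^ 2) * lowWeight w x ∂(qbar q N) ≤
      N * (A / ρ) * ρ ^ N := by
    intro N hN
    let F : Fin N → Fin N → 𝕏 → ℝ := fun j i t => if i = j then g t ^ 2 * e t else e t
    have hFi : ∀ j, Integrable (fun x : Fin N → 𝕏 => ∏ i, F j i (x i)) (qbar q N) := by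
      intro j
      refine Integrable.fintype_prod (μ := fun _ : Fin N => q) (f := F j) fun i => ?_
      by_cases h : i = j
      · simpa only [F, h, if_true] using hgei
      · simpa only [F, h, if_false] using hei
    have hFint : ∀ j, ∫ x, ∏ i, F j i (x i) ∂(qbar q N) = A / ρ * ρ ^ N := by
      intro j
      have h1 := integral_fintype_prod_eq_prod (𝕜 := ℝ) (F j) (μ := fun _ : Fin N => q)
      unfold qbar
      rw [h1, ← Finset.mul_prod_erase _ _ (Finset.mem_univ j),
        Finset.prod_congr rfl (g := fun _ => ρ)]
      · have e1 : ∫ t, F j j t ∂q = A := by simp only [F, if_true, A]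
        rw [e1, Finset.prod_const, Finset.card_erase_of_mem (Finset.mem_univ j), Finset.card_univ,
          Fintype.card_fin]
        obtain ⟨n, rfl⟩ : ∃ n, N = n + 1 := ⟨N - 1, by omega⟩
        rw [Nat.add_sub_cancel, pow_succ]
        field_simp
      · intro i hi
        simp only [F, Finset.ne_of_mem_erase hi, if_false, ρ]
    have hpt : ∀ x : Fin N → 𝕏, (∑ i, g (x i) ^ 2) * lowWeight w x ≤
        ∑ j, ∏ i, F j i (x i) := by
      intro x
      have hF : ∀ j, ∏ i, F j i (x i) = g (x j) ^ 2 * ∏ i, e (x i) := by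
        intro j
        rw [← Finset.mul_prod_erase _ _ (Finset.mem_univ j),
          ← Finset.mul_prod_erase _ (fun i => e (x i)) (Finset.mem_univ j), ← mul_assoc]
        congr 1
        · simp [F]
        · exact Finset.prod_congr rfl fun i hi => by simp [F, Finset.ne_of_mem_erase hi]
      simp_rw [hF, ← Finset.sum_mul]
      have hs : 0 ≤ ∑ i, g (x i) ^ 2 := Finset.sum_nonneg fun i _ => sq_nonneg _
      refine mul_le_mul_of_nonneg_left ?_ hs
      unfold lowWeight
      split_ifs with h
      · rw [← Real.exp_sum, Real.one_le_exp_iff, ← Finset.mul_sum, Finset.sum_sub_distrib]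
        refine mul_nonneg hl.le ?_
        have hN0 : (0 : ℝ) < N := by exact_mod_cast hN
        rw [avgWeight, inv_mul_lt_iff₀ hN0] at h
        simp
        linarith
      · exact Finset.prod_nonneg fun i _ => (he0 _).le
    calc _ ≤ ∫ x, ∑ j, ∏ i, F j i (x i) ∂(qbar q N) :=
          integral_mono_of_nonneg (ae_of_all _ fun x => mul_nonneg
            (Finset.sum_nonneg fun i _ => sq_nonneg _) (lowWeight_nonneg x))
            (integrable_finsetSum _ fun j _ => hFi j) (ae_of_all _ hpt)
      _ = _ := by
          rw [integral_finsetSum _ fun j _ => hFi j, Finset.sum_congr rfl fun j _ => hFint j]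
          simp; ring
  have hlim : Tendsto (fun N : ℕ => (A / ρ) * ((N : ℝ) ^ 2 * ρ ^ N)) atTop (𝓝 0) := by
    have := (tendsto_pow_const_mul_const_pow_of_abs_lt_one 2 (r := ρ)
      (by rwa [abs_of_pos hρ0])).const_mul (A / ρ)
    rwa [mul_zero] at this
  refine squeeze_zero' (Eventually.of_forall fun N => mul_nonneg N.cast_nonneg
    (integral_nonneg fun x => mul_nonneg (Finset.sum_nonneg fun i _ => sq_nonneg _)
      (lowWeight_nonneg x))) ?_ hlim
  filter_upwards [eventually_ge_atTop 1] with N hN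
  calc _ ≤ (N : ℝ) * (N * (A / ρ) * ρ ^ N) := by gcongr; exact hbound N hN
    _ = _ := by ring

end Majorants

/-! ### Asymptotics of plain importance sampling. -/

section Asymptotics

variable {𝕏 : Type*} [MeasurableSpace 𝕏]

/-- The standing assumptions on the weight, on the test function and on its centring. -/
structure Admissible (q : Measure 𝕏) (w f : 𝕏 → ℝ) (c : ℝ) : Prop where
  meas_w : Measurable w
  meas_f : Measurable f
  pos : ∀ᵐ x ∂q, 0 < w x
  memLp_w : MemLp w 4 q
  integral_w : ∫ x, w x ∂q = 1
  memLp_f : MemLp f 2 q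
  memLp_wf : MemLp (fun t => w t * (f t - c)) 2 q
  integral_wf : ∫ t, w t * (f t - c) ∂q = 0

namespace Admissible

variable {q : Measure 𝕏} [IsProbabilityMeasure q] {w f : 𝕏 → ℝ} {c : ℝ} {N : ℕ}

lemma memLp_w_sub_one (H : Admissible q w f c) : MemLp (fun t => w t - 1) 4 q :=
  H.memLp_w.sub (memLp_const 1)

lemma integral_w_sub_one (H : Admissible q w f c) : ∫ t, (w t - 1) ∂q = 0 := by
  rw [integral_sub (H.memLp_w.integrable (by norm_num)) (integrable_const 1), H.integral_w]
  simp

omit [MeasurableSpace 𝕏] in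
lemma avgWeight_sub_one (hN : 1 ≤ N) (x : Fin N → 𝕏) :
    avgWeight (fun t => w t - 1) x = avgWeight w x - 1 := by
  have hN0 : (N : ℝ) ≠ 0 := by positivity
  simp only [avgWeight, Finset.sum_sub_distrib, Finset.sum_const, Finset.card_univ,
    Fintype.card_fin, nsmul_eq_mul, mul_one]
  field_simp

lemma integrable_avgWeight_sub_one_pow (H : Admissible q w f c) (hN : 1 ≤ N) {k : ℕ} (hk : k ≤ 4) :
    Integrable (fun x : Fin N → 𝕏 => (avgWeight w x - 1) ^ k) (qbar q N) := by
  simp_rw [← avgWeight_sub_one hN]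
  exact integrable_pow_of_memLp (n := 4) (memLp_avgWeight H.memLp_w_sub_one N) hk

lemma integral_avgWeight_sub_one_sq (H : Admissible q w f c) (hN : 1 ≤ N) :
    ∫ x, (avgWeight w x - 1) ^ 2 ∂(qbar q N) = (N : ℝ)⁻¹ * ∫ t, (w t - 1) ^ 2 ∂q := by
  simp_rw [← avgWeight_sub_one hN]
  exact integral_avgWeight_sq (H.memLp_w_sub_one.mono_exponent (by norm_num))
    H.integral_w_sub_one N

lemma integral_avgWeight_sub_one_pow_four_le (H : Admissible q w f c) (hN : 1 ≤ N) :
    ∫ x, (avgWeight w x - 1) ^ 4 ∂(qbar q N) ≤ (N : ℝ)⁻¹ * (3 * ∫ t, (w t - 1) ^ 4 ∂q) := by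
  simp_rw [← avgWeight_sub_one hN]
  have h := integral_avgWeight_pow_four_le (H.meas_w.sub_const 1) H.memLp_w_sub_one
    H.integral_w_sub_one N
  have hN1 : (1 : ℝ) ≤ N := by exact_mod_cast hN
  rw [le_inv_mul_iff₀ (by positivity)]
  refine le_trans ?_ h
  have : 0 ≤ ∫ x, avgWeight (fun t => w t - 1) x ^ 4 ∂(qbar q N) :=
    integral_nonneg fun x => by positivity
  exact mul_le_mul_of_nonneg_right (by nlinarith) this

lemma integrable_deviation (H : Admissible q w f c) :
    Integrable (fun x : Fin N → 𝕏 => deviation w x) (qbar q N) :=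
  Integrable.of_bound (measurable_deviation H.meas_w).aestronglyMeasurable 1
    (ae_of_all _ fun x => by
      rw [Real.norm_eq_abs, abs_of_nonneg (deviation_nonneg x)]; exact deviation_le_one x)

lemma integrable_mul_deviation (H : Admissible q w f c) {U : (Fin N → 𝕏) → ℝ}
    (hU : Integrable U (qbar q N)) :
    Integrable (fun x : Fin N → 𝕏 => U x * deviation w x) (qbar q N) :=
  hU.mul_bdd (c := 1) (measurable_deviation H.meas_w).aestronglyMeasurable
    (ae_of_all _ fun x => by
      rw [Real.norm_eq_abs, abs_of_nonneg (deviation_nonneg x)]; exact deviation_le_one x)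

/-- The variance of Ẑ is of order 1/N; Young's inequality with weight √N turns it into a bound of
order N^(-1/2) on the mean deviation. -/
lemma tendsto_integral_deviation (H : Admissible q w f c) :
    Tendsto (fun N : ℕ => ∫ x : Fin N → 𝕏, deviation w x ∂(qbar q N)) atTop (𝓝 0) := by
  set v := ∫ t, (w t - 1) ^ 2 ∂q
  have hlim : Tendsto (fun N : ℕ => (1 + 4 * v) * (Real.sqrt N)⁻¹) atTop (𝓝 0) := by
    have := (tendsto_inv_atTop_zero.comp
      (Real.tendsto_sqrt_atTop.comp (tendsto_natCast_atTop_atTop (R := ℝ)))).const_mul (1 + 4 * v)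
    rwa [mul_zero] at this
  refine squeeze_zero' (Eventually.of_forall fun N =>
    integral_nonneg fun x => deviation_nonneg x) ?_ hlim
  filter_upwards [eventually_ge_atTop 1] with N hN
  have hs : 0 < Real.sqrt N := Real.sqrt_pos.2 (by exact_mod_cast hN)
  have hi := H.integrable_avgWeight_sub_one_pow hN (k := 2) (by norm_num)
  calc ∫ x : Fin N → 𝕏, deviation w x ∂(qbar q N)
      ≤ ∫ x : Fin N → 𝕏, ((Real.sqrt N)⁻¹ + 4 * Real.sqrt N * (avgWeight w x - 1) ^ 2)
          ∂(qbar q N) := by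
        refine integral_mono H.integrable_deviation ((integrable_const _).add (hi.const_mul _))
          fun x => (min_le_right _ _).trans ?_
        change 4 * |avgWeight w x - 1| ≤ (Real.sqrt N)⁻¹ + 4 * Real.sqrt N * (avgWeight w x - 1) ^ 2
        rw [← sq_abs (avgWeight w x - 1)]
        set t := |avgWeight w x - 1|
        have e : (Real.sqrt N)⁻¹ + 4 * Real.sqrt N * t ^ 2 - 4 * t
          = (Real.sqrt N)⁻¹ * (2 * Real.sqrt N * t - 1) ^ 2 := by field_simp; ring
        have : 0 ≤ (Real.sqrt N)⁻¹ * (2 * Real.sqrt N * t - 1) ^ 2 := by positivity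
        linarith
    _ = (Real.sqrt N)⁻¹ + 4 * Real.sqrt N * ((N : ℝ)⁻¹ * v) := by
        rw [integral_add (integrable_const _) (hi.const_mul _), integral_const_mul,
          H.integral_avgWeight_sub_one_sq hN]
        simp [v]
    _ = (1 + 4 * v) * (Real.sqrt N)⁻¹ := by
        have : (N : ℝ)⁻¹ = (Real.sqrt N)⁻¹ * (Real.sqrt N)⁻¹ := by
          rw [← mul_inv, Real.mul_self_sqrt N.cast_nonneg]
        rw [this]; field_simp

lemma integrable_weightMajorant (H : Admissible q w f c) (hN : 1 ≤ N) :
    Integrable (fun x : Fin N → 𝕏 => weightMajorant w x) (qbar q N) := by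
  refine (((integrable_const (4 : ℝ)).add
    ((H.integrable_avgWeight_sub_one_pow hN (k := 2) (by norm_num)).const_mul 2)).add
    ((H.integrable_avgWeight_sub_one_pow hN (k := 4) le_rfl).const_mul 2)).mono'
    (measurable_weightMajorant H.meas_w).aestronglyMeasurable (ae_of_all _ fun x => ?_)
  rw [Real.norm_eq_abs, abs_of_nonneg (zero_le_one.trans (one_le_weightMajorant x))]
  exact weightMajorant_le x

lemma integral_weightMajorant_mul_deviation_le (H : Admissible q w f c) (hN : 1 ≤ N) :
    ∫ x : Fin N → 𝕏, weightMajorant w x * deviation w x ∂(qbar q N) ≤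
      4 * (∫ x : Fin N → 𝕏, deviation w x ∂(qbar q N)) +
        (N : ℝ)⁻¹ * (2 * (∫ t, (w t - 1) ^ 2 ∂q) + 6 * ∫ t, (w t - 1) ^ 4 ∂q) := by
  have i1 := (H.integrable_deviation (N := N)).const_mul 4
  have i2 := (H.integrable_avgWeight_sub_one_pow hN (k := 2) (by norm_num)).const_mul 2
  have i4 := (H.integrable_avgWeight_sub_one_pow hN (k := 4) le_rfl).const_mul 2
  have h := integral_mono (H.integrable_mul_deviation (H.integrable_weightMajorant hN))
    ((i1.add i2).add i4) fun x => weightMajorant_mul_deviation_le x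
  rw [integral_add' (i1.add i2) i4, integral_add' i1 i2, integral_const_mul, integral_const_mul,
    integral_const_mul, H.integral_avgWeight_sub_one_sq hN] at h
  have := H.integral_avgWeight_sub_one_pow_four_le hN
  linarith

lemma tendsto_integral_weightMajorant_mul_deviation (H : Admissible q w f c) :
    Tendsto (fun N : ℕ => ∫ x : Fin N → 𝕏, weightMajorant w x * deviation w x ∂(qbar q N))
      atTop (𝓝 0) := by
  have hlim := (H.tendsto_integral_deviation.const_mul 4).add
    ((tendsto_inv_atTop_zero.comp (tendsto_natCast_atTop_atTop (R := ℝ))).mul_const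
      (2 * (∫ t, (w t - 1) ^ 2 ∂q) + 6 * ∫ t, (w t - 1) ^ 4 ∂q))
  rw [mul_zero, zero_mul, zero_add] at hlim
  refine squeeze_zero' (Eventually.of_forall fun N => integral_nonneg fun x =>
    mul_nonneg (zero_le_one.trans (one_le_weightMajorant x)) (deviation_nonneg x)) ?_ hlim
  filter_upwards [eventually_ge_atTop 1] with N hN
  exact H.integral_weightMajorant_mul_deviation_le hN

lemma integral_weightMajorant_le (H : Admissible q w f c) (hN : 1 ≤ N) :
    ∫ x : Fin N → 𝕏, weightMajorant w x ∂(qbar q N) ≤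
      4 + (2 * (∫ t, (w t - 1) ^ 2 ∂q) + 6 * ∫ t, (w t - 1) ^ 4 ∂q) := by
  have i1 : Integrable (fun _ : Fin N → 𝕏 => (4 : ℝ)) (qbar q N) := integrable_const 4
  have i2 := (H.integrable_avgWeight_sub_one_pow hN (k := 2) (by norm_num)).const_mul 2
  have i4 := (H.integrable_avgWeight_sub_one_pow hN (k := 4) le_rfl).const_mul 2
  have h := integral_mono (H.integrable_weightMajorant hN)
    ((i1.add i2).add i4) fun x => weightMajorant_le x
  rw [integral_add' (i1.add i2) i4, integral_add' i1 i2, integral_const_mul,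
    integral_const_mul, H.integral_avgWeight_sub_one_sq hN] at h
  have h4 := H.integral_avgWeight_sub_one_pow_four_le hN
  have hN1 : (N : ℝ)⁻¹ ≤ 1 := inv_le_one_of_one_le₀ (by exact_mod_cast hN)
  have v0 : 0 ≤ ∫ t, (w t - 1) ^ 2 ∂q := integral_nonneg fun t => sq_nonneg _
  have m0 : 0 ≤ ∫ t, (w t - 1) ^ 4 ∂q := integral_nonneg fun t => by positivity
  have a1 := mul_le_of_le_one_left v0 hN1
  have a2 := mul_le_of_le_one_left (by positivity : 0 ≤ 3 * ∫ t, (w t - 1) ^ 4 ∂q) hN1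
  simp only [integral_const, probReal_univ, smul_eq_mul, one_mul] at h
  linarith

lemma integrable_sq_mul_lowWeight (H : Admissible q w f c) (hN : 1 ≤ N) :
    Integrable (fun x : Fin N → 𝕏 => (isEstimator w f x - c) ^ 2 * lowWeight w x) (qbar q N) := by
  refine (integrable_sum_sq (H.memLp_f.sub (memLp_const c)) N).mono' ?_ ?_
  · have := H.meas_w
    have := H.meas_f
    exact Measurable.aestronglyMeasurable (by fun_prop)
  · filter_upwards [ae_qbar_forall H.pos N] with x hx
    rw [Real.norm_eq_abs, abs_of_nonneg (mul_nonneg (sq_nonneg _) (lowWeight_nonneg x))]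
    refine le_trans (mul_le_of_le_one_right (sq_nonneg _) ?_) (sq_isEstimator_sub_le_sum hN hx)
    unfold lowWeight; split_ifs <;> norm_num

lemma tendsto_integral_sq_mul_lowWeight (H : Admissible q w f c) :
    Tendsto (fun N : ℕ => N * ∫ x : Fin N → 𝕏, (isEstimator w f x - c) ^ 2 * lowWeight w x
      ∂(qbar q N)) atTop (𝓝 0) := by
  have hg := H.memLp_f.sub (memLp_const c)
  refine squeeze_zero' (Eventually.of_forall fun N => mul_nonneg N.cast_nonneg
    (integral_nonneg fun x => mul_nonneg (sq_nonneg _) (lowWeight_nonneg x))) ?_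
    (tendsto_integral_sum_sq_mul_lowWeight H.meas_w H.pos (H.memLp_w.mono_exponent (by norm_num))
      H.integral_w (H.meas_f.sub_const c) hg)
  filter_upwards [eventually_ge_atTop 1] with N hN
  refine mul_le_mul_of_nonneg_left ?_ N.cast_nonneg
  refine integral_mono_of_nonneg (ae_of_all _ fun x => mul_nonneg (sq_nonneg _)
    (lowWeight_nonneg x)) ?_ ?_
  · refine (integrable_sum_sq hg N).mul_bdd (c := 1)
      (measurable_lowWeight H.meas_w).aestronglyMeasurable (ae_of_all _ fun x => ?_)
    unfold lowWeight; split_ifs <;> norm_num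
  · filter_upwards [ae_qbar_forall H.pos N] with x hx
    exact mul_le_mul_of_nonneg_right (sq_isEstimator_sub_le_sum hN hx) (lowWeight_nonneg x)

lemma integrable_errorMajorant (H : Admissible q w f c) (hN : 1 ≤ N) :
    Integrable (fun x : Fin N → 𝕏 => errorMajorant w f c x) (qbar q N) :=
  ((memLp_avgWeight H.memLp_wf N).integrable_sq.const_mul 4).add (H.integrable_sq_mul_lowWeight hN)

lemma tendsto_integral_avg_sq (H : Admissible q w f c) :
    Tendsto (fun N : ℕ => N * ∫ x : Fin N → 𝕏, avgWeight (fun t => w t * (f t - c)) x ^ 2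
      ∂(qbar q N)) atTop (𝓝 (∫ t, (w t * (f t - c)) ^ 2 ∂q)) := by
  refine tendsto_const_nhds.congr' ?_
  filter_upwards [eventually_ge_atTop 1] with N hN
  have hN0 : (N : ℝ) ≠ 0 := by positivity
  rw [integral_avgWeight_sq H.memLp_wf H.integral_wf, mul_inv_cancel_left₀ hN0]

lemma tendsto_integral_avg_sq_mul_deviation (H : Admissible q w f c) :
    Tendsto (fun N : ℕ => N * ∫ x : Fin N → 𝕏, avgWeight (fun t => w t * (f t - c)) x ^ 2 *
      deviation w x ∂(qbar q N)) atTop (𝓝 0) :=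
  tendsto_integral_avgWeight_sq_mul H.memLp_wf H.integral_wf
    (fun _ => measurable_deviation H.meas_w) (fun _ => deviation_nonneg)
    (fun _ => deviation_le_one) H.tendsto_integral_deviation

lemma tendsto_integral_errorMajorant (H : Admissible q w f c) :
    Tendsto (fun N : ℕ => N * ∫ x : Fin N → 𝕏, errorMajorant w f c x ∂(qbar q N)) atTop
      (𝓝 (4 * ∫ t, (w t * (f t - c)) ^ 2 ∂q)) := by
  have hlim := (H.tendsto_integral_avg_sq.const_mul 4).add H.tendsto_integral_sq_mul_lowWeight
  rw [add_zero] at hlim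
  refine hlim.congr' ?_
  filter_upwards [eventually_ge_atTop 1] with N hN
  unfold errorMajorant
  rw [integral_add ((memLp_avgWeight H.memLp_wf N).integrable_sq.const_mul 4)
    (H.integrable_sq_mul_lowWeight hN), integral_const_mul]
  ring

lemma tendsto_integral_errorMajorant_mul_deviation (H : Admissible q w f c) :
    Tendsto (fun N : ℕ => N * ∫ x : Fin N → 𝕏, errorMajorant w f c x * deviation w x ∂(qbar q N))
      atTop (𝓝 0) := by
  have hlim := (H.tendsto_integral_avg_sq_mul_deviation.const_mul 4).add
    H.tendsto_integral_sq_mul_lowWeight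
  rw [mul_zero, add_zero] at hlim
  refine squeeze_zero' (Eventually.of_forall fun N => mul_nonneg N.cast_nonneg
    (integral_nonneg fun x => mul_nonneg (errorMajorant_nonneg x) (deviation_nonneg x))) ?_ hlim
  filter_upwards [eventually_ge_atTop 1] with N hN
  have i1 := (H.integrable_mul_deviation (memLp_avgWeight H.memLp_wf N).integrable_sq).const_mul 4
  have i2 := H.integrable_sq_mul_lowWeight hN
  have h := integral_mono (H.integrable_mul_deviation (H.integrable_errorMajorant hN))
    (i1.add i2) fun x => by
      have := mul_le_of_le_one_right (mul_nonneg (sq_nonneg (isEstimator w f x - c))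
        (lowWeight_nonneg (w := w) x)) (deviation_le_one (w := w) x)
      simp only [errorMajorant, Pi.add_apply]
      linarith
  rw [integral_add' i1 i2, integral_const_mul] at h
  calc _ ≤ (N : ℝ) * _ := mul_le_mul_of_nonneg_left h N.cast_nonneg
    _ = _ := by ring

lemma integrable_sq_isEstimator_sub (H : Admissible q w f c) (hN : 1 ≤ N) :
    Integrable (fun x : Fin N → 𝕏 => (isEstimator w f x - c) ^ 2) (qbar q N) := by
  refine (H.integrable_errorMajorant hN).mono' ?_ ?_
  · have := H.meas_w
    have := H.meas_f
    exact Measurable.aestronglyMeasurable (by fun_prop)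
  · filter_upwards [ae_avgWeight_pos H.pos hN] with x hx
    rw [Real.norm_eq_abs, abs_of_nonneg (sq_nonneg _)]
    exact sq_le_errorMajorant hx

/-- The asymptotic mean squared error of self-normalized importance sampling. -/
lemma tendsto_integral_sq_isEstimator_sub (H : Admissible q w f c) :
    Tendsto (fun N : ℕ => N * ∫ x : Fin N → 𝕏, (isEstimator w f x - c) ^ 2 ∂(qbar q N)) atTop
      (𝓝 (∫ t, (w t * (f t - c)) ^ 2 ∂q)) := by
  have hlim := (H.tendsto_integral_avg_sq_mul_deviation.const_mul 3).add
    H.tendsto_integral_sq_mul_lowWeight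
  rw [mul_zero, add_zero] at hlim
  -- Replacing Ẑ by 1 in the denominator changes the squared error by a deviation term plus a
  -- low-weight term, both o(1/N) in mean.
  have hdiff : Tendsto (fun N : ℕ =>
      (N * ∫ x : Fin N → 𝕏, (isEstimator w f x - c) ^ 2 ∂(qbar q N)) -
      N * ∫ x : Fin N → 𝕏, avgWeight (fun t => w t * (f t - c)) x ^ 2 ∂(qbar q N))
      atTop (𝓝 0) := by
    refine squeeze_zero_norm' ?_ hlim
    filter_upwards [eventually_ge_atTop 1] with N hN
    have j1 := (memLp_avgWeight H.memLp_wf N).integrable_sq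
    have j0 := H.integrable_sq_isEstimator_sub hN
    have i1 := (H.integrable_mul_deviation j1).const_mul 3
    have i2 := H.integrable_sq_mul_lowWeight hN
    rw [← mul_sub, ← integral_sub j0 j1, norm_mul, Real.norm_natCast]
    have h : ‖∫ x : Fin N → 𝕏, ((isEstimator w f x - c) ^ 2 -
        avgWeight (fun t => w t * (f t - c)) x ^ 2) ∂(qbar q N)‖ ≤
        ∫ x : Fin N → 𝕏, (3 * (avgWeight (fun t => w t * (f t - c)) x ^ 2 * deviation w x) +
          (isEstimator w f x - c) ^ 2 * lowWeight w x) ∂(qbar q N) := by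
      refine norm_integral_le_of_norm_le (i1.add i2) ?_
      filter_upwards [ae_avgWeight_pos H.pos hN] with x hx
      exact abs_sq_sub_sq_le hx
    rw [integral_add i1 i2, integral_const_mul] at h
    calc _ ≤ (N : ℝ) * _ := mul_le_mul_of_nonneg_left h N.cast_nonneg
      _ = _ := by ring
  have := hdiff.add H.tendsto_integral_avg_sq
  rw [zero_add] at this
  exact this.congr fun N => by ring

/-! ### Moments of the rejections and of the correction. -/

lemma lintegral_mul_deviation_add (H : Admissible q w f c) {U V : (Fin N → 𝕏) → ℝ}
    (hU : Integrable U (qbar q N)) (hV : Integrable V (qbar q N)) (hU0 : ∀ x, 0 ≤ U x)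
    (hV0 : ∀ x, 0 ≤ V x) :
    ∫⁻ z, ENNReal.ofReal (U z.1 * V z.2 * (deviation w z.1 + deviation w z.2))
      ∂((qbar q N).prod (qbar q N)) =
    ENNReal.ofReal ((∫ x, U x * deviation w x ∂(qbar q N)) * (∫ x, V x ∂(qbar q N)) +
      (∫ x, U x ∂(qbar q N)) * ∫ x, V x * deviation w x ∂(qbar q N)) := by
  have e : ∀ z : (Fin N → 𝕏) × (Fin N → 𝕏), U z.1 * V z.2 * (deviation w z.1 + deviation w z.2) =
      U z.1 * deviation w z.1 * V z.2 + U z.1 * (V z.2 * deviation w z.2) := fun z => by ring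
  have i1 := (H.integrable_mul_deviation hU).mul_prod hV
  have i2 := hU.mul_prod (H.integrable_mul_deviation hV)
  have i : Integrable (fun z : (Fin N → 𝕏) × (Fin N → 𝕏) =>
      U z.1 * V z.2 * (deviation w z.1 + deviation w z.2)) ((qbar q N).prod (qbar q N)) := by
    simp_rw [e]; exact i1.add i2
  rw [← ofReal_integral_eq_lintegral_ofReal i (ae_of_all _ fun z => mul_nonneg
    (mul_nonneg (hU0 _) (hV0 _)) (add_nonneg (deviation_nonneg _) (deviation_nonneg _)))]
  congr 1
  simp_rw [e]
  rw [integral_add i1 i2]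
  congr 1
  · exact integral_prod_mul (fun x => U x * deviation w x) V
  · exact integral_prod_mul U fun x => V x * deviation w x

/-- With a majorant of product form, independence of x₀ and the proposal splits the two-sample
integral, and each resulting term contains a deviation, the source of decay in N. -/
lemma integrable_rejections_and_integral_le (H : Admissible q w f c) (hN : 1 ≤ N)
    {U V : (Fin N → 𝕏) → ℝ}
    (hU : Integrable U (qbar q N)) (hV : Integrable V (qbar q N)) (hU0 : ∀ x, 0 ≤ U x)
    (hV0 : ∀ x, 0 ≤ V x) {Γ : (Fin N → 𝕏) × (Fin N → 𝕏) → ℝ} (hΓ : Measurable Γ)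
    (hΓ0 : ∀ z, 0 ≤ Γ z) (j : ℕ)
    (hle : ∀ x z, 0 < avgWeight w x → 0 < avgWeight w z →
      max 1 (avgWeight w x) ^ (j + 1) * Γ (x, z) ≤ U x * V z) :
    Integrable (fun ζ => (rejections w ζ : ℝ) ^ j * ∑ s ∈ Finset.range (rejections w ζ),
        Γ (ζ.1, (proposal ζ s).1)) (noiseLaw q N) ∧
    ∫ ζ, (rejections w ζ : ℝ) ^ j * ∑ s ∈ Finset.range (rejections w ζ),
        Γ (ζ.1, (proposal ζ s).1) ∂(noiseLaw q N) ≤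
      (j + 1).factorial * (∫ t, min 1 (w t) ∂q)⁻¹ ^ (j + 1) *
      ((∫ x, U x * deviation w x ∂(qbar q N)) * (∫ x, V x ∂(qbar q N)) +
        (∫ x, U x ∂(qbar q N)) * ∫ x, V x * deviation w x ∂(qbar q N)) := by
  set c₀ := ∫ t, min 1 (w t) ∂q
  have hc : 0 < c₀ := integral_min_one_pos H.meas_w H.pos
  have hm : Measurable (fun ζ : Noise 𝕏 N => (rejections w ζ : ℝ) ^ j *
      ∑ s ∈ Finset.range (rejections w ζ), Γ (ζ.1, (proposal ζ s).1)) :=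
    (((measurable_of_countable _).comp (measurable_rejections H.meas_w)).pow_const j).mul
      (measurable_sum_range_rejections H.meas_w fun k => hΓ.comp
        (measurable_fst.prodMk (measurable_fst.comp (measurable_proposal k))))
  have hn : ∀ ζ : Noise 𝕏 N, 0 ≤ (rejections w ζ : ℝ) ^ j *
      ∑ s ∈ Finset.range (rejections w ζ), Γ (ζ.1, (proposal ζ s).1) := fun ζ =>
    mul_nonneg (by positivity) (Finset.sum_nonneg fun s _ => hΓ0 _)
  set R := (∫ x, U x * deviation w x ∂(qbar q N)) * (∫ x, V x ∂(qbar q N)) +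
        (∫ x, U x ∂(qbar q N)) * ∫ x, V x * deviation w x ∂(qbar q N)
  have hR : 0 ≤ R := add_nonneg
    (mul_nonneg (integral_nonneg fun x => mul_nonneg (hU0 x) (deviation_nonneg x))
      (integral_nonneg hV0))
    (mul_nonneg (integral_nonneg hU0)
      (integral_nonneg fun x => mul_nonneg (hV0 x) (deviation_nonneg x)))
  have hbound : ∫⁻ ζ, ENNReal.ofReal ((rejections w ζ : ℝ) ^ j *
      ∑ s ∈ Finset.range (rejections w ζ), Γ (ζ.1, (proposal ζ s).1)) ∂(noiseLaw q N) ≤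
      ENNReal.ofReal ((j + 1).factorial * c₀⁻¹ ^ (j + 1) * R) := by
    have h := lintegral_rejections_le (q := q) (N := N) H.meas_w H.pos hN
      (Γ := fun z => ENNReal.ofReal (Γ z)) (by fun_prop) j
    have e : ∀ ζ : Noise 𝕏 N, ENNReal.ofReal ((rejections w ζ : ℝ) ^ j *
        ∑ s ∈ Finset.range (rejections w ζ), Γ (ζ.1, (proposal ζ s).1)) =
        (rejections w ζ : ℝ≥0∞) ^ j * ∑ s ∈ Finset.range (rejections w ζ),
          ENNReal.ofReal (Γ (ζ.1, (proposal ζ s).1)) := fun ζ => by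
      rw [ENNReal.ofReal_mul (by positivity), ENNReal.ofReal_pow (by positivity),
        ENNReal.ofReal_natCast, ENNReal.ofReal_sum_of_nonneg fun s _ => hΓ0 _]
    simp_rw [e]
    refine h.trans ?_
    rw [ENNReal.ofReal_mul (by positivity), ENNReal.ofReal_mul (by positivity),
      ENNReal.ofReal_natCast, mul_assoc, ← H.lintegral_mul_deviation_add hU hV hU0 hV0,
      ← lintegral_const_mul' _ _ ENNReal.ofReal_ne_top]
    refine mul_le_mul_right (lintegral_mono_ae ?_) _
    have p1 : ∀ᵐ z ∂((qbar q N).prod (qbar q N)), 0 < avgWeight w z.1 :=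
      measurePreserving_fst.quasiMeasurePreserving.ae (ae_avgWeight_pos H.pos hN)
    have p2 : ∀ᵐ z ∂((qbar q N).prod (qbar q N)), 0 < avgWeight w z.2 :=
      measurePreserving_snd.quasiMeasurePreserving.ae (ae_avgWeight_pos H.pos hN)
    filter_upwards [p1, p2] with z hx hz
    rw [← ENNReal.ofReal_mul' (hΓ0 z), ← ENNReal.ofReal_mul (by positivity)]
    refine ENNReal.ofReal_le_ofReal ?_
    have h1 := one_sub_div_le hx hz
    have h2 := hle z.1 z.2 hx hz
    have hd : 0 ≤ deviation w z.1 + deviation w z.2 :=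
      add_nonneg (deviation_nonneg _) (deviation_nonneg _)
    have h3 : 0 ≤ c₀⁻¹ ^ (j + 1) * (max 1 (avgWeight w z.1) ^ (j + 1) * Γ z) :=
      mul_nonneg (by positivity) (mul_nonneg (by positivity) (hΓ0 z))
    calc _ = c₀⁻¹ ^ (j + 1) * (max 1 (avgWeight w z.1) ^ (j + 1) * Γ z) *
          (1 - avgWeight w z.2 / avgWeight w z.1) := by rw [div_eq_mul_inv, mul_pow]; ring
      _ ≤ c₀⁻¹ ^ (j + 1) * (max 1 (avgWeight w z.1) ^ (j + 1) * Γ z) *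
          (deviation w z.1 + deviation w z.2) := mul_le_mul_of_nonneg_left h1 h3
      _ ≤ c₀⁻¹ ^ (j + 1) * (U z.1 * V z.2) * (deviation w z.1 + deviation w z.2) := by
          gcongr
      _ = _ := by ring
  refine ⟨⟨hm.aestronglyMeasurable, ?_⟩, ?_⟩
  · rw [hasFiniteIntegral_iff_ofReal (ae_of_all _ hn)]
    exact hbound.trans_lt ENNReal.ofReal_lt_top
  · rw [integral_eq_lintegral_of_nonneg_ae (ae_of_all _ hn) hm.aestronglyMeasurable]
    exact ENNReal.toReal_le_of_le_ofReal (by positivity) hbound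

lemma integrable_rejections_sq_and_integral_le (H : Admissible q w f c) (hN : 1 ≤ N) :
    Integrable (fun ζ => (rejections w ζ : ℝ) ^ 2) (noiseLaw q N) ∧
    ∫ ζ, (rejections w ζ : ℝ) ^ 2 ∂(noiseLaw q N) ≤
      2 * (∫ t, min 1 (w t) ∂q)⁻¹ ^ 2 *
      ((∫ x : Fin N → 𝕏, weightMajorant w x * deviation w x ∂(qbar q N)) +
        (∫ x : Fin N → 𝕏, weightMajorant w x ∂(qbar q N)) *
          ∫ x : Fin N → 𝕏, deviation w x ∂(qbar q N)) := by
  have h := H.integrable_rejections_and_integral_le hN (H.integrable_weightMajorant hN)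
    (V := fun _ => 1) (integrable_const 1) (fun x => zero_le_one.trans (one_le_weightMajorant x))
    (fun _ => zero_le_one) (Γ := fun _ => 1) measurable_const (fun _ => zero_le_one) 1
    (fun x z _ _ => by
      rw [mul_one, mul_one]
      exact pow_le_pow_right₀ (le_max_left _ _) (by norm_num))
  simpa [sq, pow_one, Nat.factorial] using h

lemma integrable_rejections (H : Admissible q w f c) (hN : 1 ≤ N) :
    Integrable (fun ζ => (rejections w ζ : ℝ)) (noiseLaw q N) := by
  refine (H.integrable_rejections_sq_and_integral_le hN).1.mono'
    ((measurable_of_countable _).comp (measurable_rejections H.meas_w)).aestronglyMeasurable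
    (ae_of_all _ fun ζ => ?_)
  rw [Real.norm_natCast]
  exact_mod_cast Nat.le_self_pow two_ne_zero _

lemma tendsto_integral_rejections (H : Admissible q w f c) :
    Tendsto (fun N : ℕ => ∫ ζ, (rejections w ζ : ℝ) ∂(noiseLaw q N)) atTop (𝓝 0) := by
  set b₀ := 4 + (2 * (∫ t, (w t - 1) ^ 2 ∂q) + 6 * ∫ t, (w t - 1) ^ 4 ∂q)
  have hlim := ((H.tendsto_integral_weightMajorant_mul_deviation).add
    (H.tendsto_integral_deviation.const_mul b₀)).const_mul (2 * (∫ t, min 1 (w t) ∂q)⁻¹ ^ 2)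
  rw [mul_zero, add_zero, mul_zero] at hlim
  refine squeeze_zero' (Eventually.of_forall fun N =>
    integral_nonneg fun ζ => Nat.cast_nonneg _) ?_ hlim
  filter_upwards [eventually_ge_atTop 1] with N hN
  obtain ⟨i, h⟩ := H.integrable_rejections_sq_and_integral_le hN
  calc ∫ ζ, (rejections w ζ : ℝ) ∂(noiseLaw q N) ≤ ∫ ζ, (rejections w ζ : ℝ) ^ 2 ∂(noiseLaw q N) :=
        integral_mono (H.integrable_rejections hN) i fun ζ => by
          have : rejections w ζ ≤ rejections w ζ ^ 2 := Nat.le_self_pow two_ne_zero _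
          change (rejections w ζ : ℝ) ≤ (rejections w ζ : ℝ) ^ 2
          exact_mod_cast this
    _ ≤ _ := h
    _ ≤ _ := by
        have h0 : 0 ≤ ∫ x : Fin N → 𝕏, deviation w x ∂(qbar q N) :=
          integral_nonneg fun x => deviation_nonneg x
        gcongr
        exact H.integral_weightMajorant_le hN

/-- A bound for the mean squared correction made by the unbiased estimator. -/
lemma integrable_sq_correction_and_integral_le (H : Admissible q w f c) (hN : 1 ≤ N) :
    Integrable (fun ζ => (uisEstimator w f ζ - isEstimator w f ζ.1) ^ 2) (noiseLaw q N) ∧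
    ∫ ζ, (uisEstimator w f ζ - isEstimator w f ζ.1) ^ 2 ∂(noiseLaw q N) ≤
      4 * (∫ t, min 1 (w t) ∂q)⁻¹ ^ 2 *
      ((∫ x : Fin N → 𝕏, errorMajorant w f c x * deviation w x ∂(qbar q N)) +
        (∫ x : Fin N → 𝕏, errorMajorant w f c x ∂(qbar q N)) *
          ∫ x : Fin N → 𝕏, deviation w x ∂(qbar q N)) +
      12 * (∫ t, min 1 (w t) ∂q)⁻¹ ^ 3 *
      ((∫ x : Fin N → 𝕏, weightMajorant w x * deviation w x ∂(qbar q N)) *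
        (∫ x : Fin N → 𝕏, errorMajorant w f c x ∂(qbar q N)) +
        (∫ x : Fin N → 𝕏, weightMajorant w x ∂(qbar q N)) *
          ∫ x : Fin N → 𝕏, errorMajorant w f c x * deviation w x ∂(qbar q N)) := by
  have hw := H.meas_w
  have hf := H.meas_f
  -- Error at x₀: two powers of the weight, absorbed by the error majorant. Next comes the error at
  -- the proposals: three powers of the weight, carried by the independent factor `weightMajorant`.
  -- The constants 4 and 12 are 2·2! and 2·3!.
  obtain ⟨i1, h1⟩ := H.integrable_rejections_and_integral_le hN (H.integrable_errorMajorant hN)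
    (V := fun _ => 1) (integrable_const 1) errorMajorant_nonneg
    (fun _ => zero_le_one) (Γ := fun z => (isEstimator w f z.1 - c) ^ 2) (by fun_prop)
    (fun _ => sq_nonneg _) 1
    (fun x z hx _ => by rw [mul_one]; exact sq_max_mul_le_errorMajorant hx)
  obtain ⟨i2, h2⟩ := H.integrable_rejections_and_integral_le hN (H.integrable_weightMajorant hN)
    (H.integrable_errorMajorant hN) (fun x => zero_le_one.trans (one_le_weightMajorant x))
    errorMajorant_nonneg (Γ := fun z => (isEstimator w f z.2 - c) ^ 2) (by fun_prop)
    (fun _ => sq_nonneg _) 2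
    (fun x z _ hz => mul_le_mul_of_nonneg_left (sq_le_errorMajorant hz)
      (zero_le_one.trans (one_le_weightMajorant x)))
  have hreg := ae_regular (q := q) (N := N) H.meas_w H.pos hN
  have hle : ∀ᵐ ζ ∂(noiseLaw q N), (uisEstimator w f ζ - isEstimator w f ζ.1) ^ 2 ≤ _ :=
    hreg.mono fun ζ hζ => hζ.sq_uisEstimator_sub_le f c
  have hm : AEStronglyMeasurable (fun ζ : Noise 𝕏 N =>
      (uisEstimator w f ζ - isEstimator w f ζ.1) ^ 2) (noiseLaw q N) := by
    have hm' : Measurable (fun ζ : Noise 𝕏 N => (∑ k ∈ Finset.range (rejections w ζ),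
        (isEstimator w f ζ.1 - isEstimator w f (yChain w ζ k))) ^ 2) :=
      (measurable_sum_range_rejections hw fun k =>
        ((measurable_isEstimator hw hf).comp measurable_fst).sub
          ((measurable_isEstimator hw hf).comp (measurable_yChain hw k))).pow_const 2
    refine hm'.aestronglyMeasurable.congr ?_
    filter_upwards [hreg] with ζ hζ
    rw [hζ.uisEstimator_eq, add_sub_cancel_left]
  have j1 := i1.const_mul 2
  have j2 := i2.const_mul 2
  have hi : Integrable (fun ζ => (uisEstimator w f ζ - isEstimator w f ζ.1) ^ 2)
      (noiseLaw q N) := by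
    refine (j1.add j2).mono' hm ?_
    filter_upwards [hle] with ζ hζ
    rw [Real.norm_eq_abs, abs_of_nonneg (sq_nonneg _)]
    exact hζ
  refine ⟨hi, ?_⟩
  have h := integral_mono_ae hi (j1.add j2) hle
  rw [integral_add' j1 j2, integral_const_mul, integral_const_mul] at h
  simp only [integral_const, probReal_univ, smul_eq_mul, mul_one, one_mul] at h1
  norm_num [Nat.factorial] at h1 h2 h ⊢
  linarith

lemma tendsto_integral_sq_correction (H : Admissible q w f c) :
    Tendsto (fun N : ℕ => N * ∫ ζ, (uisEstimator w f ζ - isEstimator w f ζ.1) ^ 2 ∂(noiseLaw q N))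
      atTop (𝓝 0) := by
  set b₀ := 4 + (2 * (∫ t, (w t - 1) ^ 2 ∂q) + 6 * ∫ t, (w t - 1) ^ 4 ∂q)
  have hlim := ((H.tendsto_integral_errorMajorant_mul_deviation.add
    (H.tendsto_integral_errorMajorant.mul H.tendsto_integral_deviation)).const_mul
      (4 * (∫ t, min 1 (w t) ∂q)⁻¹ ^ 2)).add
    (((H.tendsto_integral_weightMajorant_mul_deviation.mul H.tendsto_integral_errorMajorant).add
      (H.tendsto_integral_errorMajorant_mul_deviation.const_mul b₀)).const_mul
      (12 * (∫ t, min 1 (w t) ∂q)⁻¹ ^ 3))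
  simp only [mul_zero, zero_mul, add_zero] at hlim
  refine squeeze_zero' (Eventually.of_forall fun N => mul_nonneg N.cast_nonneg
    (integral_nonneg fun ζ => sq_nonneg _)) ?_ hlim
  filter_upwards [eventually_ge_atTop 1] with N hN
  have h := (H.integrable_sq_correction_and_integral_le hN).2
  have hb := H.integral_weightMajorant_le hN
  have h0 : 0 ≤ ∫ x : Fin N → 𝕏, errorMajorant w f c x * deviation w x ∂(qbar q N) :=
    integral_nonneg fun x => mul_nonneg (errorMajorant_nonneg x) (deviation_nonneg x)
  have hc : 0 < ∫ t, min 1 (w t) ∂q := integral_min_one_pos H.meas_w H.pos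
  calc _ ≤ (N : ℝ) * _ := mul_le_mul_of_nonneg_left h N.cast_nonneg
    _ ≤ (N : ℝ) * (4 * (∫ t, min 1 (w t) ∂q)⁻¹ ^ 2 *
      ((∫ x : Fin N → 𝕏, errorMajorant w f c x * deviation w x ∂(qbar q N)) +
        (∫ x : Fin N → 𝕏, errorMajorant w f c x ∂(qbar q N)) *
          ∫ x : Fin N → 𝕏, deviation w x ∂(qbar q N)) +
      12 * (∫ t, min 1 (w t) ∂q)⁻¹ ^ 3 *
      ((∫ x : Fin N → 𝕏, weightMajorant w x * deviation w x ∂(qbar q N)) *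
        (∫ x : Fin N → 𝕏, errorMajorant w f c x ∂(qbar q N)) +
        b₀ * ∫ x : Fin N → 𝕏, errorMajorant w f c x * deviation w x ∂(qbar q N))) := by
        gcongr
    _ = _ := by ring

lemma aestronglyMeasurable_uisEstimator (H : Admissible q w f c) (hN : 1 ≤ N) :
    AEStronglyMeasurable (fun ζ => uisEstimator w f ζ) (noiseLaw q N) := by
  have hm' : Measurable (fun ζ : Noise 𝕏 N => isEstimator w f ζ.1 +
      ∑ k ∈ Finset.range (rejections w ζ),
        (isEstimator w f ζ.1 - isEstimator w f (yChain w ζ k))) :=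
    ((measurable_isEstimator H.meas_w H.meas_f).comp measurable_fst).add
      (measurable_sum_range_rejections H.meas_w fun k =>
        ((measurable_isEstimator H.meas_w H.meas_f).comp measurable_fst).sub
          ((measurable_isEstimator H.meas_w H.meas_f).comp (measurable_yChain H.meas_w k)))
  refine hm'.aestronglyMeasurable.congr ?_
  filter_upwards [ae_regular (q := q) (N := N) H.meas_w H.pos hN] with ζ hζ
  rw [hζ.uisEstimator_eq]

lemma integrable_sq_init (H : Admissible q w f c) (hN : 1 ≤ N) :
    Integrable (fun ζ : Noise 𝕏 N => (isEstimator w f ζ.1 - c) ^ 2) (noiseLaw q N) :=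
  measurePreserving_fst_noiseLaw.integrable_comp_of_integrable (H.integrable_sq_isEstimator_sub hN)

lemma integral_sq_init (H : Admissible q w f c) :
    ∫ ζ : Noise 𝕏 N, (isEstimator w f ζ.1 - c) ^ 2 ∂(noiseLaw q N) =
      ∫ x : Fin N → 𝕏, (isEstimator w f x - c) ^ 2 ∂(qbar q N) := by
  have hm : Measurable fun x : Fin N → 𝕏 => (isEstimator w f x - c) ^ 2 := by
    have := H.meas_w
    have := H.meas_f
    fun_prop
  rw [← (measurePreserving_fst_noiseLaw (q := q) (N := N)).map_eq,
    integral_map measurable_fst.aemeasurable hm.aestronglyMeasurable]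

lemma integrable_sq_uisEstimator_sub (H : Admissible q w f c) (hN : 1 ≤ N) :
    Integrable (fun ζ => (uisEstimator w f ζ - c) ^ 2) (noiseLaw q N) := by
  refine (((H.integrable_sq_init hN).const_mul 2).add
    ((H.integrable_sq_correction_and_integral_le hN).1.const_mul 2)).mono'
    (((H.aestronglyMeasurable_uisEstimator hN).sub aestronglyMeasurable_const).pow 2)
    (ae_of_all _ fun ζ => ?_)
  simp only [Real.norm_eq_abs, Pi.add_apply]
  rw [abs_of_nonneg (sq_nonneg _)]
  nlinarith [sq_nonneg ((isEstimator w f ζ.1 - c) - (uisEstimator w f ζ - isEstimator w f ζ.1))]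

/-- Young's inequality 2|GD| ≤ εG² + ε⁻¹D² for the initial error G and the correction D. The
parameter ε is left free so that it may depend on N. -/
lemma abs_integral_sq_sub_le (H : Admissible q w f c) (hN : 1 ≤ N) {ε : ℝ} (hε : 0 < ε) :
    |∫ ζ, (uisEstimator w f ζ - c) ^ 2 ∂(noiseLaw q N) -
      ∫ x : Fin N → 𝕏, (isEstimator w f x - c) ^ 2 ∂(qbar q N)| ≤
    ε * (∫ x : Fin N → 𝕏, (isEstimator w f x - c) ^ 2 ∂(qbar q N)) + (1 + ε⁻¹) *
      ∫ ζ, (uisEstimator w f ζ - isEstimator w f ζ.1) ^ 2 ∂(noiseLaw q N) := by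
  have i0 := H.integrable_sq_uisEstimator_sub hN
  have i1 := H.integrable_sq_init hN
  have i2 := (H.integrable_sq_correction_and_integral_le hN).1
  rw [← H.integral_sq_init, ← integral_sub i0 i1, ← integral_const_mul, ← integral_const_mul,
    ← integral_add (i1.const_mul _) (i2.const_mul _), ← Real.norm_eq_abs]
  refine norm_integral_le_of_norm_le ((i1.const_mul _).add (i2.const_mul _))
    (ae_of_all _ fun ζ => ?_)
  rw [Real.norm_eq_abs]
  set G := isEstimator w f ζ.1 - c
  set D := uisEstimator w f ζ - isEstimator w f ζ.1
  have e : uisEstimator w f ζ - c = G + D := by simp only [G, D]; ring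
  have p1 : 0 ≤ ε⁻¹ * (ε * G - D) ^ 2 := by positivity
  have p2 : 0 ≤ ε⁻¹ * (ε * G + D) ^ 2 := by positivity
  have q1 : ε⁻¹ * (ε * G - D) ^ 2 = ε * G ^ 2 - 2 * (G * D) + ε⁻¹ * D ^ 2 := by field_simp; ring
  have q2 : ε⁻¹ * (ε * G + D) ^ 2 = ε * G ^ 2 + 2 * (G * D) + ε⁻¹ * D ^ 2 := by field_simp; ring
  rw [e, abs_le]
  constructor <;> nlinarith [sq_nonneg D]

/-- The unbiased estimator has the same asymptotic mean squared error as the plain one. -/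
lemma tendsto_integral_sq_uisEstimator_sub (H : Admissible q w f c) :
    Tendsto (fun N : ℕ => N * ∫ ζ, (uisEstimator w f ζ - c) ^ 2 ∂(noiseLaw q N)) atTop
      (𝓝 (∫ t, (w t * (f t - c)) ^ 2 ∂q)) := by
  set A : ℕ → ℝ := fun N => N * ∫ x : Fin N → 𝕏, (isEstimator w f x - c) ^ 2 ∂(qbar q N)
  set R : ℕ → ℝ := fun N =>
    N * ∫ ζ, (uisEstimator w f ζ - isEstimator w f ζ.1) ^ 2 ∂(noiseLaw q N)
  have hA : Tendsto A atTop (𝓝 (∫ t, (w t * (f t - c)) ^ 2 ∂q)) :=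
    H.tendsto_integral_sq_isEstimator_sub
  have hR : Tendsto R atTop (𝓝 0) := H.tendsto_integral_sq_correction
  have hsR : Tendsto (fun N => Real.sqrt (R N)) atTop (𝓝 0) := by
    have := (Real.continuous_sqrt.tendsto 0).comp hR
    rwa [Real.sqrt_zero] at this
  have hlim := (((hsR.add (tendsto_inv_atTop_zero.comp
    (tendsto_natCast_atTop_atTop (R := ℝ)))).mul hA).add hR).add hsR
  simp only [add_zero, zero_mul] at hlim
  have hdiff : Tendsto (fun N : ℕ => N * (∫ ζ, (uisEstimator w f ζ - c) ^ 2 ∂(noiseLaw q N)) - A N)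
      atTop (𝓝 0) := by
    refine squeeze_zero_norm' ?_ hlim
    filter_upwards [eventually_ge_atTop 1] with N hN
    have hN0 : (0 : ℝ) < N := by exact_mod_cast hN
    have hR0 : 0 ≤ R N := mul_nonneg hN0.le (integral_nonneg fun ζ => sq_nonneg _)
    -- This ε tends to 0 while R/ε ≤ √R also does; the summand 1/N keeps it positive when R
    -- vanishes.
    have hε : 0 < Real.sqrt (R N) + (N : ℝ)⁻¹ := by positivity
    have h := mul_le_mul_of_nonneg_left (H.abs_integral_sq_sub_le hN hε) hN0.le
    have hr : (Real.sqrt (R N) + (N : ℝ)⁻¹)⁻¹ * R N ≤ Real.sqrt (R N) := by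
      rw [inv_mul_le_iff₀ hε]
      nth_rw 1 [← Real.mul_self_sqrt hR0]
      gcongr
      simp
    rw [Real.norm_eq_abs]
    simp only [A, ← mul_sub, Function.comp_apply]
    rw [abs_mul, abs_of_pos hN0]
    refine h.trans ?_
    simp only [R] at hr ⊢
    linarith
  have := hdiff.add hA
  rw [zero_add] at this
  exact this.congr fun N => by ring

end Admissible

end Asymptotics

/-! ### From the moment conditions to the theorem. -/

lemma four_lt_of_moment_condition {p : ℝ} {r : ℝ≥0∞} (hr : 2 < r)
    (hpr : r ≠ ∞ → 2 * p + 4 * r.toReal + 4 < r.toReal * p) (hpr_top : r = ∞ → 4 < p) : 4 < p := by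
  by_cases h : r = ∞
  · exact hpr_top h
  · have h1 := hpr h
    have h2 : 2 < r.toReal := by
      simpa using (ENNReal.toReal_lt_toReal ENNReal.ofNat_ne_top h).2 hr
    by_contra hp
    -- If p ≤ 4, then p(r - 2) ≤ 4r - 8 < 4r + 4, against the hypothesis.
    nlinarith

lemma memLp_four_of_integrable_rpow {𝕏 : Type*} [MeasurableSpace 𝕏] {q : Measure 𝕏}
    [IsProbabilityMeasure q] {w : 𝕏 → ℝ} (hw : Measurable w) (hpos : ∀ᵐ x ∂q, 0 < w x) {p : ℝ}
    (hp : 4 < p) (hwp : Integrable (fun x => w x ^ p) q) : MemLp w 4 q := by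
  refine memLp_four_of_integrable hw.aestronglyMeasurable ?_
  refine ((integrable_const (1 : ℝ)).add hwp).mono' (hw.pow_const 4).aestronglyMeasurable ?_
  filter_upwards [hpos] with x hx
  rw [Real.norm_eq_abs, abs_of_nonneg (by positivity), Pi.add_apply]
  rcases le_total (w x) 1 with h | h
  · have := pow_le_one₀ (n := 4) hx.le h
    have := Real.rpow_nonneg hx.le p
    linarith
  · have := Real.rpow_le_rpow_of_exponent_le h hp.le
    have e : w x ^ (4 : ℝ) = w x ^ 4 := by exact_mod_cast Real.rpow_natCast (w x) 4
    rw [e] at this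
    linarith

/-- Importance sampling weights and test functions with enough moments are admissible. -/
lemma admissible_of_rnDeriv {𝕏 : Type*} [MeasurableSpace 𝕏] {q π : Measure 𝕏}
    [IsProbabilityMeasure q] [IsProbabilityMeasure π] (hπq : π ≪ q) {w : 𝕏 → ℝ}
    (hw : Measurable w) (hw_density : w =ᵐ[q] fun x => (π.rnDeriv q x).toReal)
    (hpos : ∀ᵐ x ∂q, 0 < w x) {f : 𝕏 → ℝ} (hf : Measurable f) (hw4 : MemLp w 4 q)
    (hf2 : MemLp f 2 q) (hfw : Integrable (fun x => f x ^ 2 * w x ^ 2) q) :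
    Integrable f π ∧ Admissible q w f (∫ x, f x ∂π) := by
  have hwfL : MemLp (fun x => w x * f x) 2 q := by
    rw [memLp_two_iff_integrable_sq (Measurable.aestronglyMeasurable (by fun_prop))]
    refine hfw.congr (ae_of_all _ fun x => ?_)
    dsimp only
    ring
  have hwi : Integrable w q := hw4.integrable (by norm_num)
  have hint : ∀ g : 𝕏 → ℝ, ∫ x, w x * g x ∂q = ∫ x, g x ∂π := by
    intro g
    rw [← integral_rnDeriv_smul hπq]
    refine integral_congr_ae ?_
    filter_upwards [hw_density] with x hx
    rw [hx, smul_eq_mul]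
  have hw1 : ∫ x, w x ∂q = 1 := by simpa using hint fun _ => 1
  have hwfi := hwfL.integrable one_le_two
  refine ⟨?_, hw, hf, hpos, hw4, hw1, hf2, ?_, ?_⟩
  · rw [← integrable_rnDeriv_smul_iff hπq]
    refine hwfi.congr ?_
    filter_upwards [hw_density] with x hx
    rw [hx, smul_eq_mul]
  · refine (hwfL.sub ((hw4.mono_exponent (by norm_num)).mul_const (∫ x, f x ∂π))).ae_eq
      (ae_of_all _ fun x => ?_)
    simp only [Pi.sub_apply]
    ring
  · simp_rw [mul_sub]
    rw [integral_sub hwfi (hwi.mul_const _), integral_mul_const, hw1, hint f]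
    ring

end UIS

theorem mainTheorem12 {𝕏 : Type*} [MeasurableSpace 𝕏]
    (q π : Measure 𝕏) [IsProbabilityMeasure q] [IsProbabilityMeasure π]
    (hπq : π ≪ q)
    -- `w` is (a version of) the weight function `dπ/dq`, almost surely positive under `q`
    (w : 𝕏 → ℝ) (hw : Measurable w)
    (hw_density : w =ᵐ[q] fun x => (π.rnDeriv q x).toReal)
    (hw_pos : ∀ᵐ x ∂q, 0 < w x)
    -- the test function
    (f : 𝕏 → ℝ) (hf : Measurable f)
    -- the moment conditions, with `2 < p < ∞` and `2 < r ≤ ∞`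
    (p : ℝ) (r : ℝ≥0∞) (hp : 2 < p) (hr : 2 < r)
    (hwp : Integrable (fun x => w x ^ p) q)
    (hfr : MemLp f r q)
    (hfw : Integrable (fun x => f x ^ 2 * w x ^ 2) q)
    (hpr : r ≠ ∞ → 2 * p + 4 * r.toReal + 4 < r.toReal * p)
    (hpr_top : r = ∞ → 4 < p) :
    -- all the quantities are well defined and finite for every `N ≥ 1`
    (∀ N : ℕ, 1 ≤ N →
      (∀ᵐ ζ ∂(UIS.noiseLaw q N), UIS.meetingTime w ζ < ⊤) ∧
      Integrable (fun ζ => UIS.uisCost w ζ) (UIS.noiseLaw q N) ∧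
      Integrable (fun ζ => (UIS.uisEstimator w f ζ - ∫ x, f x ∂π) ^ 2) (UIS.noiseLaw q N) ∧
      Integrable (fun x => (UIS.isEstimator w f x - ∫ x, f x ∂π) ^ 2) (UIS.qbar q N)) ∧
    Integrable f π ∧
    -- both limits exist, are finite, and the first is twice the second
    ∃ L : ℝ,
      Tendsto (fun N : ℕ =>
          (∫ ζ, UIS.uisCost w ζ ∂(UIS.noiseLaw q N)) *
            ∫ ζ, (UIS.uisEstimator w f ζ - ∫ x, f x ∂π) ^ 2 ∂(UIS.noiseLaw q N))
        atTop (𝓝 (2 * L)) ∧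
      Tendsto (fun N : ℕ =>
          (N : ℝ) * ∫ x, (UIS.isEstimator w f x - ∫ x, f x ∂π) ^ 2 ∂(UIS.qbar q N))
        atTop (𝓝 L) := by
  have hp4 := UIS.four_lt_of_moment_condition hr hpr hpr_top
  obtain ⟨hfπ, H⟩ := UIS.admissible_of_rnDeriv hπq hw hw_density hw_pos hf
    (UIS.memLp_four_of_integrable_rpow hw hw_pos hp4 hwp) (hfr.mono_exponent hr.le) hfw
  have hreg : ∀ N : ℕ, 1 ≤ N → ∀ᵐ ζ ∂(UIS.noiseLaw q N), UIS.Regular w ζ :=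
    fun N hN => UIS.ae_regular hw hw_pos hN
  have hcost : ∀ N : ℕ, 1 ≤ N → (fun ζ : UIS.Noise 𝕏 N => N * (2 + (UIS.rejections w ζ : ℝ)))
      =ᵐ[UIS.noiseLaw q N] fun ζ => UIS.uisCost w ζ := fun N hN => by
    filter_upwards [hreg N hN] with ζ hζ using hζ.uisCost_eq.symm
  refine ⟨fun N hN => ⟨?_, ?_, H.integrable_sq_uisEstimator_sub hN,
    H.integrable_sq_isEstimator_sub hN⟩, hfπ, _, ?_, H.tendsto_integral_sq_isEstimator_sub⟩
  · filter_upwards [hreg N hN] with ζ hζ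
    rw [hζ.meetingTime_eq]
    exact ENat.natCast_lt_top _
  · exact (((integrable_const 2).add (H.integrable_rejections hN)).const_mul _).congr (hcost N hN)
  · have hlim := (H.tendsto_integral_rejections.const_add 2).mul
      H.tendsto_integral_sq_uisEstimator_sub
    rw [add_zero] at hlim
    -- The factor N of the cost N(2 + K) is moved onto the mean squared error.
    refine hlim.congr' ?_
    filter_upwards [eventually_ge_atTop 1] with N hN
    rw [← integral_congr_ae (hcost N hN), integral_const_mul,
      integral_add (integrable_const 2) (H.integrable_rejections hN)]
    simp only [integral_const, probReal_univ, smul_eq_mul, one_mul]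
    ring
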